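/- Let $D>1$ be a squarefree integer, $K=\mathbb{Q}(\sqrt D)\subset\mathbb{R}$ with Galois conjugation $a\mapsto\overline a$, ring of integers $\mathcal{O}_K$ with $\mathbb{Z}$-basis $\{1,\alpha_K\}$, where $\alpha_K=\frac{1+\sqrt D}{2}$ if $D\equiv1\pmod 4$ and $\alpha_K=\sqrt D$ otherwise, and fundamental unit $\varepsilon>1$. Identify $V_K=K\otimes_{\mathbb Q}\mathbb{R}$ with $\mathbb{R}^2$ by $a\otimes1\mapsto(\overline a,a)$, with coordinates $(s,u)$; put $\mathbf N(s,u)=|su|$ and $\mathbb{T}_K=V_K/\mathcal{O}_K$, and let $\phi$ be the automorphism of $\mathbb{T}_K$ induced by multiplication by $\varepsilon$. For $P\in\mathbb{T}_K$ let $M(P)=\inf_{Q\in\mathcal{O}_K}\mathbf N(P-Q)$ (computed with any representative of $P$ in $V_K$), for $t>0$ let $X_t=\{P\in\mathbb{T}_K : M(P)\ge t\}$, and let $M_1(K)=\sup_{P\in K}M(P)$. Let $R_0$, $R_1$ be the images in $\mathbb{T}_K$ of the planar open rectangles $(0,-\overline{\alpha_K})\times(0,1)$ and $(-1,0)\times(0,\alpha_K)$,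 whose union in the plane is called the footprint. Let $\mathscr{P}_0=\{R_0,R_1\}$ if $D=5$, and otherwise let $\mathscr{P}_0$ be the set of connected components of the sets $A_0\cap\phi^{-1}(A_1)$ with $A_0,A_1\in\{R_0,R_1\}$. For $n\ge0$ let $\mathscr{P}_n$ be the set of nonempty intersections $A=\bigcap_{i=-n}^{n}\phi^{-i}(A_i)$ with all $A_i\in\mathscr{P}_0$; the word $A_{-n}\cdots A_n$ is the coordinate word of $A$. Let $\Sigma\subseteq\mathscr{P}_0^{\mathbb Z}$ be the set of strings $(s_k)_{k\in\mathbb{Z}}$ with $s_k\cap\phi^{-1}(s_{k+1})\ne\emptyset$ for all $k$, with the shift $\sigma(s)_k=s_{k+1}$, and for $\mathscr{C}\subseteq\mathscr{P}_n$ let $\Sigma\langle\mathscr{C}\rangle$ be the subshift of all $s\in\Sigma$ in which no coordinate word of an element of $\mathscr{C}$ occurs. For finite $I\subseteq\mathcal{O}_K$ let $\mathscr{T}_n(t,I)$ be the set of $A\in\mathscr{P}_n$ such that the closure in $V_K$ of the representative of $A$ in the footprint is contained in $\bigcup_{Q\in I}\{P\in V_K : \mathbf N(P-Q)<t\}$.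 Finally let $I_K$ be the set of all $q\in\mathcal{O}_K$ such that, for some $R\in\mathscr{P}_0$ with planar representative $\widetilde R$ in the footprint, $\widetilde R-q$ meets the rectangle $|s|,|u|<\sqrt{\varepsilon(M_1(K)+1)}$. Then $I_K$ is finite, and for every $t>0$ and every finite $I\subseteq\mathcal{O}_K$ with $I_K\subseteq I$, $$h(\phi|X_t)=\lim_{n\to\infty}h\bigl(\sigma|\Sigma\langle\mathscr{T}_n(t,I)\rangle\bigr),$$ where $h$ denotes topological entropy (with the convention that the entropy of the empty system is $-\infty$). -/

import Mathlib

open Set Filter Topology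

noncomputable section

namespace RealQuad

/-! ### The real quadratic field `K = ℚ(√D)`, as a subfield of `ℝ` -/

/-- The field `ℚ(√D)`, embedded in `ℝ`. -/
abbrev K (D : ℕ) : IntermediateField ℚ ℝ := IntermediateField.adjoin ℚ {√(D : ℝ)}

/-- `√D` as an element of `K`. -/
def sqrtD (D : ℕ) : K D := ⟨√(D : ℝ), IntermediateField.mem_adjoin_simple_self ℚ _⟩

lemma exists_conj (D : ℕ) (hD : 1 < D) (hsq : Squarefree D) :
    ∃ τ : K D ≃ₐ[ℚ] K D, τ (sqrtD D) = -sqrtD D := by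
  have hirr : Irrational √(D : ℝ) := by
    rw [irrational_sqrt_natCast_iff]
    rintro ⟨r, hr⟩
    have h1 : IsUnit r := hsq r ⟨1, by simp [hr]⟩
    rw [Nat.isUnit_iff] at h1
    subst h1
    omega
  have hs : √(D : ℝ) ^ 2 = D := Real.sq_sqrt (by positivity)
  have hs' : sqrtD D ^ 2 = (D : K D) := Subtype.ext (by simpa [sqrtD] using hs)
  have hmonic : (Polynomial.X ^ 2 - Polynomial.C (D : ℚ)).Monic :=
    Polynomial.monic_X_pow_sub_C _ two_ne_zero
  have hint : IsIntegral ℚ √(D : ℝ) :=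
    ⟨Polynomial.X ^ 2 - Polynomial.C (D : ℚ), hmonic, by simp [hs]⟩
  have hmin : Polynomial.X ^ 2 - Polynomial.C (D : ℚ) = minpoly ℚ √(D : ℝ) := by
    refine minpoly.eq_of_irreducible_of_monic ?_ (by simp [hs]) hmonic
    have hdeg : (Polynomial.X ^ 2 - Polynomial.C (D : ℚ)).natDegree = 2 :=
      Polynomial.natDegree_X_pow_sub_C
    rw [Polynomial.irreducible_iff_roots_eq_zero_of_degree_le_three (by rw [hdeg])
      (by rw [hdeg]; norm_num), Multiset.eq_zero_iff_forall_notMem]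
    intro q hq
    have hq2 : q ^ 2 = (D : ℚ) := by
      have := (Polynomial.mem_roots'.1 hq).2
      simpa [Polynomial.IsRoot, sub_eq_zero] using this
    apply hirr
    refine ⟨|q|, ?_⟩
    have h2 : ((q : ℝ)) ^ 2 = (D : ℝ) := by exact_mod_cast hq2
    rw [← h2, Real.sqrt_sq_eq_abs]
    push_cast
    rfl
  have hroot : -sqrtD D ∈ (minpoly ℚ √(D : ℝ)).aroots (K D) := by
    rw [← hmin, Polynomial.mem_aroots]
    exact ⟨hmonic.ne_zero, by simp [hs']⟩
  let f : K D →ₐ[ℚ] K D :=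
    (IntermediateField.algHomAdjoinIntegralEquiv ℚ hint).symm ⟨_, hroot⟩
  have hf : f (sqrtD D) = -sqrtD D :=
    IntermediateField.algHomAdjoinIntegralEquiv_symm_apply_gen ℚ hint ⟨_, hroot⟩
  have : FiniteDimensional ℚ (K D) := IntermediateField.adjoin.finiteDimensional hint
  exact ⟨AlgEquiv.ofBijective f (Algebra.IsAlgebraic.algHom_bijective f), hf⟩

open Classical in
/-- Galois conjugation `a ↦ ā`: the automorphism of `K` with `√D ↦ -√D`
(it exists whenever `D > 1` is squarefree). -/
def conj (D : ℕ) : K D ≃ₐ[ℚ] K D :=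
  if h : ∃ τ : K D ≃ₐ[ℚ] K D, τ (sqrtD D) = -sqrtD D then h.choose else 1

lemma conj_sqrtD (D : ℕ) (hD : 1 < D) (hsq : Squarefree D) :
    conj D (sqrtD D) = -sqrtD D := by
  have h := exists_conj D hD hsq
  rw [conj, dif_pos h]
  exact h.choose_spec

/-- The ring of integers of `K`. -/
abbrev OK (D : ℕ) : Type := NumberField.RingOfIntegers (K D)

/-- The generator `α_K` of `𝓞 K = ℤ ⊕ ℤ α_K`. -/
def alpha (D : ℕ) : K D := if D % 4 = 1 then (1 + sqrtD D) / 2 else sqrtD D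

/-! ### The plane `V_K = K ⊗ ℝ`, in stable and unstable coordinates `(s, u)`, and the torus -/

/-- `V_K`, identified with `ℝ × ℝ` through `a ⊗ 1 ↦ (ā, a)`. -/
abbrev V : Type := ℝ × ℝ

/-- The embedding `a ↦ (ā, a)` of `K` into `V_K`. -/
def emb (D : ℕ) : K D →+* V :=
  RingHom.prod ((algebraMap (K D) ℝ).comp (conj D : K D →+* K D)) (algebraMap (K D) ℝ)

/-- The embedding of `𝓞 K` into `V_K`. -/
def embO (D : ℕ) : OK D →+* V := (emb D).comp (algebraMap (OK D) (K D))

/-- `𝓞 K` as a lattice in `V_K`. -/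
def lattice (D : ℕ) : AddSubgroup V := (embO D).toAddMonoidHom.range

/-- The torus `𝕋_K = V_K / 𝓞 K`, with its quotient topology and uniformity. -/
abbrev Torus (D : ℕ) : Type := V ⧸ lattice D

/-- The projection of the plane onto the torus. -/
def proj (D : ℕ) : V → Torus D := fun v => (v : V ⧸ lattice D)

/-- Multiplication by the unit `ε` on `V_K`; in coordinates, `(s, u) ↦ (ε̄ s, ε u)`. -/
def phiV (D : ℕ) (ε : (OK D)ˣ) : V ≃+ V where
  toFun v := embO D (ε : OK D) * v
  invFun v := embO D ((ε⁻¹ : (OK D)ˣ) : OK D) * v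
  left_inv v := by
    simp only
    rw [← mul_assoc, ← map_mul, Units.inv_mul, map_one, one_mul]
  right_inv v := by
    simp only
    rw [← mul_assoc, ← map_mul, Units.mul_inv, map_one, one_mul]
  map_add' v w := mul_add _ v w

lemma phiV_map_lattice (D : ℕ) (ε : (OK D)ˣ) :
    (lattice D).map ((phiV D ε : V ≃+ V) : V →+ V) = lattice D := by
  ext v
  constructor
  · rintro ⟨_, ⟨a, rfl⟩, rfl⟩
    exact ⟨(ε : OK D) * a, map_mul (embO D) _ _⟩
  · rintro ⟨a, rfl⟩
    refine ⟨embO D (((ε⁻¹ : (OK D)ˣ) : OK D) * a), ⟨_, rfl⟩, ?_⟩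
    change embO D (ε : OK D) * embO D (((ε⁻¹ : (OK D)ˣ) : OK D) * a) = embO D a
    rw [← map_mul, Units.mul_inv_cancel_left]

/-- The automorphism `φ` of the torus induced by multiplication by `ε`. -/
def phi (D : ℕ) (ε : (OK D)ˣ) : Equiv.Perm (Torus D) :=
  (QuotientAddGroup.congr (lattice D) (lattice D) (phiV D ε) (phiV_map_lattice D ε)).toEquiv

/-! ### The norm form, the function `M`, and the sets `X_t` -/

/-- The absolute norm, extended to the plane: `N(s, u) = |s u|`. -/
def absNorm (v : V) : ℝ := |v.1 * v.2|

/-- `M(P) = inf_{Q ∈ 𝓞 K} N(P - Q)` on the plane. -/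
def MV (D : ℕ) (v : V) : ℝ := ⨅ q : lattice D, absNorm (v - q)

lemma MV_congr (D : ℕ) (v w : V) (h : v - w ∈ lattice D) : MV D v = MV D w := by
  refine Equiv.iInf_congr (Equiv.subRight (⟨v - w, h⟩ : lattice D)) fun q => ?_
  simp only [Equiv.subRight_apply, AddSubgroup.coe_sub]
  congr 1
  abel

/-- The function `M` on the torus. -/
def M (D : ℕ) : Torus D → ℝ :=
  Quotient.lift (MV D) fun v w h => by
    have h' := (lattice D).neg_mem (QuotientAddGroup.leftRel_apply.1 h)
    exact MV_congr D v w (by simpa [sub_eq_add_neg, add_comm] using h')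

/-- The Euclidean minimum `M₁(K) = sup_{P ∈ K} M(P)`. -/
def M1 (D : ℕ) : ℝ := ⨆ a : K D, M D (proj D (emb D a))

/-- `X_t = {P ∈ 𝕋_K | M(P) ≥ t}`. -/
def X (D : ℕ) (t : ℝ) : Set (Torus D) := {P | t ≤ M D P}

/-! ### The Markov partitions `P_n` -/

/-- The rectangles of the original two-rectangle partition, in the plane: `R₀` is
`(0, -ᾱ_K) × (0, 1)` and `R₁` is `(-1, 0) × (0, α_K)`, in coordinates `(s, u)`. -/
def planeR (D : ℕ) : Fin 2 → Set V :=
  ![Ioo 0 (-(emb D (alpha D)).1) ×ˢ Ioo 0 1, Ioo (-1) 0 ×ˢ Ioo 0 (emb D (alpha D)).2]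

/-- The footprint `R₀ ∪ R₁` in the plane; it maps injectively to the torus. -/
def footprint (D : ℕ) : Set V := planeR D 0 ∪ planeR D 1

/-- The rectangles `R₀` and `R₁` on the torus. -/
def torusR (D : ℕ) (i : Fin 2) : Set (Torus D) := proj D '' planeR D i

/-- The initial Markov generator: `{R₀, R₁}` for `ℚ(√5)`, and for every other `K` the set of
connected components of the intersections `A₀ ∩ φ⁻¹(A₁)`, `A₀, A₁ ∈ {R₀, R₁}`. -/
def P0 (D : ℕ) (ε : (OK D)ˣ) : Set (Set (Torus D)) :=
  if D = 5 then range (torusR D)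
  else {C | ∃ i j : Fin 2, ∃ P ∈ torusR D i ∩ phi D ε ⁻¹' torusR D j,
    C = connectedComponentIn (torusR D i ∩ phi D ε ⁻¹' torusR D j) P}

/-- Words `A_{-n} ⋯ A_0 ⋯ A_n` in the alphabet `P_0`. -/
abbrev Word (D : ℕ) (ε : (OK D)ˣ) (n : ℕ) : Type := Icc (-(n : ℤ)) n → P0 D ε

/-- The set `φⁿ(A_{-n}) ∩ ⋯ ∩ A_0 ∩ ⋯ ∩ φ⁻ⁿ(A_n)`. -/
def rect (D : ℕ) (ε : (OK D)ˣ) (n : ℕ) (w : Word D ε n) : Set (Torus D) :=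
  ⋂ i : Icc (-(n : ℤ)) n, (phi D ε ^ (i : ℤ)) ⁻¹' (w i : Set (Torus D))

/-- The `n`-th refinement `P_n`: all nonempty intersections as above. -/
def P (D : ℕ) (ε : (OK D)ˣ) (n : ℕ) : Set (Set (Torus D)) :=
  {A | A.Nonempty ∧ ∃ w : Word D ε n, A = rect D ε n w}

/-- The planar representative of a subset of the torus inside the footprint `R₀ ∪ R₁`. -/
def rep (D : ℕ) (A : Set (Torus D)) : Set V := footprint D ∩ proj D ⁻¹' A

/-! ### Symbolic dynamics -/

/-- The shift `σ(s)_i = s_{i+1}`. -/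
def shift {A : Type*} (s : ℤ → A) : ℤ → A := fun i => s (i + 1)

/-- The topological entropy of the shift on a shift-invariant set `S` of bi-infinite strings over
the discrete alphabet `A`. -/
def shiftEntropy {A : Type*} (S : Set (ℤ → A)) : EReal :=
  letI : UniformSpace A := ⊥
  Dynamics.coverEntropy (shift : (ℤ → A) → ℤ → A) S

/-- The set `Σ` of admissible bi-infinite strings in the alphabet `P_0`. -/
def Sig (D : ℕ) (ε : (OK D)ˣ) : Set (ℤ → P0 D ε) :=
  {s | ∀ k : ℤ, ((s k : Set (Torus D)) ∩ phi D ε ⁻¹' (s (k + 1) : Set (Torus D))).Nonempty}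

/-- For a collection `C ⊆ P_n`, the subshift `Σ⟨C⟩` of `Σ` avoiding the coordinate words of the
elements of `C`. -/
def SigAvoid (D : ℕ) (ε : (OK D)ˣ) (n : ℕ) (C : Set (Set (Torus D))) : Set (ℤ → P0 D ε) :=
  {s ∈ Sig D ε | ∀ w : Word D ε n, rect D ε n w ∈ C →
    ¬ ∃ k : ℤ, ∀ i : Icc (-(n : ℤ)) n, s (k + i) = w i}

/-! ### Trapping rectangles -/

/-- `U(t, I) = ⋃_{Q ∈ I} {P ∈ V_K | N(P - Q) < t}`. -/
def U (D : ℕ) (t : ℝ) (I : Set (OK D)) : Set V := ⋃ q ∈ I, {v | absNorm (v - embO D q) < t}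

/-- `T_n(t, I)`: the rectangles of `P_n` whose (planar) closures lie in `U(t, I)`. -/
def T (D : ℕ) (ε : (OK D)ˣ) (n : ℕ) (t : ℝ) (I : Set (OK D)) : Set (Set (Torus D)) :=
  {A ∈ P D ε n | closure (rep D A) ⊆ U D t I}

/-- The rectangle `|s|, |u| < √(ε (M₁(K) + 1))`. -/
def Rbig (D : ℕ) (ε : (OK D)ˣ) : Set V :=
  {v | |v.1| < √((embO D (ε : OK D)).2 * (M1 D + 1)) ∧
    |v.2| < √((embO D (ε : OK D)).2 * (M1 D + 1))}

/-- `I_K`: the lattice points `q` such that `R - q` meets the rectangle above for some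
`R ∈ P_0`. -/
def IK (D : ℕ) (ε : (OK D)ˣ) : Set (OK D) :=
  {q | ∃ R ∈ P0 D ε, ∃ v ∈ rep D R, v - embO D q ∈ Rbig D ε}

/-- `ε` is the fundamental unit with `ε > 1` in the fixed embedding `K ⊆ ℝ`. -/
def IsFundamentalUnit (D : ℕ) (ε : (OK D)ˣ) : Prop :=
  1 < (((ε : OK D) : K D) : ℝ) ∧ ∀ u : (OK D)ˣ, ∃ n : ℤ, u = ε ^ n ∨ u = -ε ^ n

end RealQuad

end

/-!
The translates of the footprint by the lattice tile the plane, and multiplication by `ε` stretches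
the rectangles along `u`, shrinks them along `s` and respects their edges; this makes the torus a
quotient of the symbolic system `Σ` under a coding map that commutes with the dynamics. The coding
map is not injective, but orbits that stay close to a given one are coded by boundedly many words of
each length, so that the strings over `X_t` have the same entropy as `φ` on `X_t`.

A point with `M < t` has an orbit that meets `U(t, I)`: since `M < M₁ + 1` everywhere (periodic
points lie in `K` and shadow every orbit), the flow brings some difference with a lattice point, of
norm `< min(t, M₁ + 1)`, into the box `|s|, |u| < √(ε(M₁ + 1))`, and this lattice point then
belongs to `I_K`. As `U(t, I)` is open, a whole rectangle around the orbit is trapped. Hence the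
strings over `X_t` are precisely those which avoid the trapped words of all large lengths, and upper
semicontinuity of the entropy of subshifts gives the limit.
-/

open Set Filter Topology

noncomputable section

namespace RealQuad

/-! ### Words and the entropy of subshifts -/

section Symbolic

open Dynamics ExpGrowth Uniformity

lemma encard_image_le_of_determined {ι β γ : Type*} {S : Set ι} {f : ι → β} {d : ι → γ}
    (h : ∀ x ∈ S, ∀ y ∈ S, d x = d y → f x = f y) : (f '' S).encard ≤ (d '' S).encard := by
  obtain ⟨S', hS', hd⟩ := exists_subset_bijOn S d
  have hf : f '' S ⊆ f '' S' := by
    rintro _ ⟨x, hx, rfl⟩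
    obtain ⟨y, hy, hyx⟩ := hd.surjOn ⟨x, hx, rfl⟩
    exact ⟨y, hy, h _ (hS' hy) _ hx hyx⟩
  calc (f '' S).encard ≤ (f '' S').encard := encard_le_encard hf
    _ ≤ S'.encard := encard_image_le f S'
    _ = (d '' S).encard := by rw [← hd.image_eq, hd.injOn.encard_image]

lemma coverMincard_le_encard_image {X β : Type*} {T : X → X} {S : Set X} {U : SetRel X X} {m : ℕ}
    (f : X → β) (h : ∀ x ∈ S, ∀ y ∈ S, f x = f y → (x, y) ∈ dynEntourage T U m) :
    coverMincard T S U m ≤ (f '' S).encard := by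
  obtain ⟨S', hS', hf⟩ := exists_subset_bijOn S f
  rw [← hf.image_eq, hf.injOn.encard_image]
  obtain hfin | hinf := S'.finite_or_infinite
  · rw [hfin.encard_eq_coe_toFinset_card]
    refine IsDynCoverOf.coverMincard_le_card fun x hx => ?_
    obtain ⟨y, hy, hyx⟩ := hf.surjOn ⟨x, hx, rfl⟩
    exact ⟨y, by simpa using hy, h x hx y (hS' hy) hyx.symm⟩
  · simp [hinf.encard_eq]

lemma encard_image_le_mul_coverMincard {X ι β : Type*} {T : X → X} {F : Set X} {V : SetRel X X}
    {m C : ℕ} (hC : C ≠ 0) {S : Set ι} {g : ι → X} (hg : MapsTo g S F) (f : ι → β)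
    (h : ∀ x, (f '' {s ∈ S | (g s, x) ∈ dynEntourage T V m}).encard ≤ C) :
    (f '' S).encard ≤ C * coverMincard T F V m := by
  by_cases htop : coverMincard T F V m = ⊤
  · rw [htop, ENat.mul_top (by exact_mod_cast hC)]
    exact le_top
  obtain ⟨t, ht, htc⟩ := (coverMincard_finite_iff T F V m).1 (lt_top_iff_ne_top.2 htop)
  have hsub : f '' S ⊆ ⋃ x ∈ t, f '' {s ∈ S | (g s, x) ∈ dynEntourage T V m} := by
    rintro _ ⟨s, hs, rfl⟩
    obtain ⟨x, hx, hsx⟩ := ht (hg hs)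
    exact mem_biUnion hx ⟨s, ⟨hs, hsx⟩, rfl⟩
  calc (f '' S).encard ≤ ∑ x ∈ t, (f '' {s ∈ S | (g s, x) ∈ dynEntourage T V m}).encard :=
        (encard_le_encard hsub).trans (Finset.set_encard_biUnion_le t _)
    _ ≤ ∑ _x ∈ t, (C : ℕ∞) := Finset.sum_le_sum fun x _ => h x
    _ = C * coverMincard T F V m := by rw [Finset.sum_const, nsmul_eq_mul, htc, mul_comm]

variable {A : Type*}

/-- The words of length `m` occurring in the strings of `S` at the positions `0, …, m - 1`. -/
def words (S : Set (ℤ → A)) (m : ℕ) : Set (Ico (0 : ℤ) m → A) := (Ico (0 : ℤ) m).domRestrict '' S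

/-- The entourage of pairs of strings that agree at the positions `-j, …, j`. -/
def agreeRel (A : Type*) (j : ℕ) : SetRel (ℤ → A) (ℤ → A) := {p | EqOn p.1 p.2 (Icc (-(j : ℤ)) j)}

instance (j : ℕ) : (agreeRel A j).IsSymm := ⟨fun _ _ h => EqOn.symm h⟩

lemma agreeRel_comp_self_subset (j : ℕ) : (agreeRel A j).comp (agreeRel A j) ⊆ agreeRel A j := by
  rintro p ⟨y, h1, h2⟩
  exact EqOn.trans h1 h2

lemma iterate_shift_apply (n : ℕ) (s : ℤ → A) (i : ℤ) : shift^[n] s i = s (i + n) := by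
  induction n generalizing s with
  | zero => simp
  | succ n ih => rw [Function.iterate_succ_apply, ih, shift, add_assoc, Nat.cast_succ]

lemma mem_dynEntourage_agreeRel {j m : ℕ} {s s' : ℤ → A} :
    (s, s') ∈ dynEntourage shift (agreeRel A j) m ↔
      ∀ k < m, ∀ i ∈ Icc (-(j : ℤ)) j, s (i + k) = s' (i + k) := by
  simp only [mem_dynEntourage, agreeRel, EqOn, mem_ofPred_eq, iterate_shift_apply]

lemma hasBasis_uniformity_agreeRel (A : Type*) : letI : UniformSpace A := ⊥
    (𝓤 (ℤ → A)).HasBasis (fun _ : ℕ => True) (agreeRel A) := by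
  let : UniformSpace A := ⊥
  have hcomap (i : ℤ) : comap (fun a : (ℤ → A) × (ℤ → A) => (a.1 i, a.2 i)) (𝓤 A) =
      𝓟 {p | p.1 i = p.2 i} := by
    rw [show 𝓤 A = 𝓟 SetRel.id from rfl, comap_principal]
    rfl
  have hbasis := hasBasis_iInf_principal_finite
    fun i : ℤ => {p : (ℤ → A) × (ℤ → A) | p.1 i = p.2 i}
  simp only [← hcomap, ← Pi.uniformity] at hbasis
  refine hbasis.to_hasBasis (fun I hI => ?_) fun j _ =>
    ⟨Icc (-(j : ℤ)) j, finite_Icc _ _, fun p hp i hi => mem_iInter₂.1 hp i hi⟩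
  obtain ⟨B, hB⟩ := (hI.image Int.natAbs).bddAbove
  refine ⟨B, trivial, fun p hp => mem_iInter₂.2 fun i hi => hp ?_⟩
  have : i.natAbs ≤ B := hB ⟨i, hi, rfl⟩
  exact ⟨by omega, by omega⟩

lemma encard_words_le_coverMincard (S : Set (ℤ → A)) (m : ℕ) :
    (words S m).encard ≤ coverMincard shift S (agreeRel A 0) m := by
  have hfibre (x : ℤ → A) : ((Ico (0 : ℤ) m).domRestrict ''
      {s ∈ S | (s, x) ∈ dynEntourage shift (agreeRel A 0) m}).Subsingleton := by
    have heq : ∀ s, (s, x) ∈ dynEntourage shift (agreeRel A 0) m →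
        (Ico (0 : ℤ) m).domRestrict s = (Ico (0 : ℤ) m).domRestrict x := by
      intro s hs
      funext ⟨i, hi0, him⟩
      lift i to ℕ using hi0
      simpa using mem_dynEntourage_agreeRel.1 hs i (by exact_mod_cast him) 0 (by simp)
    rintro _ ⟨s, ⟨-, hs⟩, rfl⟩ _ ⟨s', ⟨-, hs'⟩, rfl⟩
    exact (heq s hs).trans (heq s' hs').symm
  simpa [words] using encard_image_le_mul_coverMincard one_ne_zero (mapsTo_id S) _
    fun x => encard_le_one_iff_subsingleton.2 (hfibre x)

lemma coverMincard_agreeRel_le (S : Set (ℤ → A)) (j m : ℕ) :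
    coverMincard shift S (agreeRel A j) m ≤
      (words S m).encard * ENat.card ((Ico (-j : ℤ) 0 → A) × (Ico (0 : ℤ) j → A)) := by
  refine (coverMincard_le_encard_image (fun s => ((Ico (0 : ℤ) m).domRestrict s,
    (Ico (-j : ℤ) 0).domRestrict s, (Ico (0 : ℤ) j).domRestrict fun i => s (m + i))) ?_).trans ?_
  · intro s _ s' _ h
    simp only [Prod.mk.injEq, funext_iff, Subtype.forall, domRestrict_apply] at h
    obtain ⟨hmid, hleft, hright⟩ := h
    rw [mem_dynEntourage_agreeRel]
    intro k hk i ⟨hi, hi'⟩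
    obtain hneg | hpos := lt_or_ge (i + k) 0
    · exact hleft _ ⟨by omega, hneg⟩
    obtain hm | hm := lt_or_ge (i + k) m
    · exact hmid _ ⟨hpos, hm⟩
    · simpa using hright (i + k - m) ⟨by omega, by omega⟩
  · rw [← encard_univ, ← encard_prod]
    refine encard_le_encard ?_
    rintro _ ⟨s, hs, rfl⟩
    exact ⟨⟨s, hs, rfl⟩, trivial⟩

lemma shiftEntropy_le_coverEntropyEntourage_agreeRel_zero [Finite A] (S : Set (ℤ → A)) :
    shiftEntropy S ≤ coverEntropyEntourage shift S (agreeRel A 0) := by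
  let : UniformSpace A := ⊥
  rw [shiftEntropy, coverEntropy_eq_iSup_basis (hasBasis_uniformity_agreeRel A)]
  refine iSup₂_le fun j _ => expGrowthSup_le_of_eventually_le
    (b := ENat.card ((Ico (-j : ℤ) 0 → A) × (Ico (0 : ℤ) j → A)))
    (by rw [ENat.card_eq_coe_natCard, ENat.toENNReal_coe]; exact ENNReal.natCast_ne_top _)
    (Eventually.of_forall fun m => ?_)
  rw [← ENat.toENNReal_mul, mul_comm]
  exact ENat.toENNReal_mono ((coverMincard_agreeRel_le S j m).trans
    (mul_le_mul_left (encard_words_le_coverMincard S m) _))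

lemma shiftEntropy_le_log_encard_words_div [Finite A] {S : Set (ℤ → A)} (hS : MapsTo shift S S)
    {m : ℕ} (hm : m ≠ 0) : shiftEntropy S ≤ ENNReal.log (words S m).encard / m := by
  have hcover : coverMincard shift S (agreeRel A 0) m ≤ (words S m).encard := by
    simpa using coverMincard_agreeRel_le S 0 m
  calc shiftEntropy S ≤ coverEntropyEntourage shift S (agreeRel A 0) :=
        shiftEntropy_le_coverEntropyEntourage_agreeRel_zero S
    _ ≤ coverEntropyEntourage shift S ((agreeRel A 0).comp (agreeRel A 0)) :=
        coverEntropyEntourage_antitone shift S (agreeRel_comp_self_subset 0)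
    _ ≤ ENNReal.log (coverMincard shift S (agreeRel A 0) m) / m :=
        coverEntropyEntourage_le_log_coverMincard_div hS hm
    _ ≤ ENNReal.log (words S m).encard / m :=
        EReal.monotone_div_right_of_nonneg m.cast_nonneg'
          (ENNReal.log_monotone (ENat.toENNReal_mono hcover))

lemma shiftEntropy_mono {S S' : Set (ℤ → A)} (h : S ⊆ S') : shiftEntropy S ≤ shiftEntropy S' :=
  letI : UniformSpace A := ⊥
  coverEntropy_monotone shift h

lemma coverEntropy_image_le_shiftEntropy {X : Type*} [UniformSpace X] {T : X → X}
    {p : (ℤ → A) → X} (hp : Function.Semiconj p shift T)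
    (hc : ∀ V ∈ 𝓤 X, ∃ j : ℕ, ∀ s s', EqOn s s' (Icc (-(j : ℤ)) j) → (p s, p s') ∈ V)
    (S : Set (ℤ → A)) : coverEntropy T (p '' S) ≤ shiftEntropy S := by
  let : UniformSpace A := ⊥
  refine coverEntropy_image_le_of_uniformContinuous hp (fun V hV => ?_) S
  obtain ⟨j, hj⟩ := hc V hV
  exact (hasBasis_uniformity_agreeRel A).mem_iff.2 ⟨j, trivial, fun q hq => hj q.1 q.2 hq⟩

lemma setOf_eqOn_Icc_mem_nhds [TopologicalSpace A] [DiscreteTopology A] (s : ℤ → A) (a b : ℤ) :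
    {s' | EqOn s s' (Icc a b)} ∈ 𝓝 s := by
  have heq : {s' | EqOn s s' (Icc a b)} = (Icc a b).pi fun i => {s i} := by
    ext s'
    simp [EqOn, Set.mem_pi, eq_comm]
  rw [heq]
  exact set_pi_mem_nhds (finite_Icc _ _) fun i _ => mem_nhds_discrete.2 rfl

lemma eventually_words_subset [Finite A] {Sn : ℕ → Set (ℤ → A)} {S : Set (ℤ → A)}
    (h : ∀ s ∉ S, ∃ j : ℕ, ∀ᶠ n in atTop, ∀ s' ∈ Sn n, ¬ EqOn s s' (Icc (-(j : ℤ)) j)) (m : ℕ) :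
    ∀ᶠ n in atTop, words (Sn n) m ⊆ words S m := by
  let : TopologicalSpace A := ⊥
  have : DiscreteTopology A := ⟨rfl⟩
  suffices hword : ∀ w, w ∉ words S m → ∀ᶠ n in atTop, w ∉ words (Sn n) m by
    filter_upwards [eventually_all.2 fun w => eventually_imp_distrib_left.2 (hword w)] with n hn w
    exact not_imp_not.1 (hn w)
  intro w hw
  have hcyl : IsCompact {s : ℤ → A | (Ico (0 : ℤ) m).domRestrict s = w} :=
    (isClosed_eq (continuous_pi fun i => continuous_apply _) continuous_const).isCompact
  have hlocal : ∀ s ∈ {s : ℤ → A | (Ico (0 : ℤ) m).domRestrict s = w},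
      {p : ℕ × (ℤ → A) | p.2 ∉ Sn p.1} ∈ atTop ×ˢ 𝓝 s := by
    intro s hs
    obtain ⟨j, hj⟩ := h s fun hsS => hw ⟨s, hsS, hs⟩
    filter_upwards [prod_mem_prod hj (setOf_eqOn_Icc_mem_nhds s (-j) j)] with p hp hpS
    exact hp.1 p.2 hpS hp.2
  obtain ⟨N, hN, K, hK, hNK⟩ := mem_prod_iff.1 (hcyl.mem_prod_nhdsSet_of_forall hlocal)
  filter_upwards [hN] with n hn ⟨s, hs, hsw⟩
  exact hNK (mk_mem_prod hn (subset_of_mem_nhdsSet hK hsw)) hs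

lemma limsup_shiftEntropy_le_coverEntropyEntourage [Finite A] {X : Type*} {T : X → X} {F : Set X}
    {V : SetRel X X} {Sn : ℕ → Set (ℤ → A)} {S : Set (ℤ → A)}
    (hinv : ∀ n, MapsTo shift (Sn n) (Sn n))
    (hwords : ∀ m, ∀ᶠ n in atTop, words (Sn n) m ⊆ words S m) {C : ℕ}
    (hC : ∀ m ≠ 0, (words S m).encard ≤ C * coverMincard T F V m) :
    limsup (fun n => shiftEntropy (Sn n)) atTop ≤ coverEntropyEntourage T F V := by
  have hbound : ∀ m ≠ 0, limsup (fun n => shiftEntropy (Sn n)) atTop ≤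
      ENNReal.log ((C : ENNReal) * (coverMincard T F V m : ENNReal)) / m := by
    intro m hm
    refine limsup_le_of_le (by isBoundedDefault) ((hwords m).mono fun n hn => ?_)
    refine (shiftEntropy_le_log_encard_words_div (hinv n) hm).trans
      (EReal.monotone_div_right_of_nonneg m.cast_nonneg' (ENNReal.log_monotone ?_))
    simpa using ENat.toENNReal_mono ((encard_le_encard hn).trans (hC m hm))
  calc limsup (fun n => shiftEntropy (Sn n)) atTop
      ≤ expGrowthSup (fun m => (C : ENNReal) * (coverMincard T F V m : ENNReal)) :=
        le_limsup_of_frequently_le ((eventually_ne_atTop 0).mono hbound).frequently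
          (by isBoundedDefault)
    _ ≤ coverEntropyEntourage T F V := expGrowthSup_le_of_eventually_le
        (ENNReal.natCast_ne_top C) (Eventually.of_forall fun m => le_rfl)

lemma tendsto_shiftEntropy [Finite A] {X : Type*} [UniformSpace X] {T : X → X} {F : Set X}
    {Sn : ℕ → Set (ℤ → A)} {S : Set (ℤ → A)} (hinv : ∀ n, MapsTo shift (Sn n) (Sn n))
    (hle : ∀ n, S ⊆ Sn n)
    (hlim : ∀ s ∉ S, ∃ j : ℕ, ∀ᶠ n in atTop, ∀ s' ∈ Sn n, ¬ EqOn s s' (Icc (-(j : ℤ)) j))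
    (hfac : coverEntropy T F ≤ shiftEntropy S) {V : SetRel X X} (hV : V ∈ 𝓤 X) {C : ℕ}
    (hC : ∀ m ≠ 0, (words S m).encard ≤ C * coverMincard T F V m) :
    Tendsto (fun n => shiftEntropy (Sn n)) atTop (𝓝 (coverEntropy T F)) :=
  tendsto_of_le_liminf_of_limsup_le
    (le_liminf_of_le (by isBoundedDefault)
      (Eventually.of_forall fun n => hfac.trans (shiftEntropy_mono (hle n))))
    ((limsup_shiftEntropy_le_coverEntropyEntourage hinv (eventually_words_subset hlim) hC).trans
      (coverEntropyEntourage_le_coverEntropy T F hV))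

end Symbolic

/-! ### The ring of integers as a lattice in the plane -/

section Arithmetic

lemma exists_intCast_eq_of_isIntegral {F : Type*} [Field F] [CharZero F] {z : ℚ}
    (hz : IsIntegral ℤ (z : F)) : ∃ m : ℤ, z = m := by
  have hzQ : IsIntegral ℤ z := by
    rw [← isIntegral_algebraMap_iff (B := F) (algebraMap ℚ F).injective]
    simpa using hz
  obtain ⟨m, hm⟩ := IsIntegrallyClosed.isIntegral_iff.1 hzQ
  exact ⟨m, by simpa using hm.symm⟩

lemma exists_intCast_eq_of_squarefree_mul_sq {d : ℕ} (hd : Squarefree d) {t : ℚ} {n : ℤ}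
    (h : d * t ^ 2 = n) : ∃ k : ℤ, t = k := by
  have hnum : (d : ℤ) * t.num ^ 2 = n * (t.den : ℤ) ^ 2 := by
    have : (d : ℚ) * (t.num : ℚ) ^ 2 = n * (t.den : ℚ) ^ 2 := by
      rw [← Rat.mul_den_eq_num t, ← h]
      ring
    exact_mod_cast this
  have hcop : IsCoprime ((t.den : ℤ) ^ 2) (t.num ^ 2) :=
    (Int.isCoprime_iff_nat_coprime.2 (by simpa using t.reduced)).symm.pow
  have hdvd : (t.den : ℤ) ^ 2 ∣ d := hcop.dvd_of_dvd_mul_right ⟨n, by rw [hnum, mul_comm]⟩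
  have hden : t.den = 1 := Nat.isUnit_iff.1 (hd _ (by rw [← sq]; exact_mod_cast hdvd))
  exact ⟨t.num, (Rat.coe_int_num_of_den_eq_one hden).symm⟩

lemma parity_of_sq_sub_mul_sq {d : ℕ} (hd : ¬ 4 ∣ d) {m k n : ℤ} (h : m ^ 2 - d * k ^ 2 = 4 * n) :
    if d % 4 = 1 then Even (m - k) else Even m ∧ Even k := by
  have hmod : (m ^ 2 - (d % 4 : ℕ) * k ^ 2) % 4 = 0 := by
    have hd4 : (d : ℤ) = 4 * (d / 4 : ℕ) + (d % 4 : ℕ) := by omega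
    have : m ^ 2 - (d % 4 : ℕ) * k ^ 2 = 4 * (n + (d / 4 : ℕ) * k ^ 2) := by
      linear_combination h + k ^ 2 * hd4
    omega
  rw [Int.sub_emod, Int.mul_emod, pow_two, pow_two, Int.mul_emod m, Int.mul_emod k] at hmod
  have hm : m % 4 = 0 ∨ m % 4 = 1 ∨ m % 4 = 2 ∨ m % 4 = 3 := by omega
  have hk : k % 4 = 0 ∨ k % 4 = 1 ∨ k % 4 = 2 ∨ k % 4 = 3 := by omega
  have hd' : d % 4 = 1 ∨ d % 4 = 2 ∨ d % 4 = 3 := by omega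
  simp only [Int.even_iff]
  split_ifs <;> rcases hm with hm | hm | hm | hm <;> rcases hk with hk | hk | hk | hk <;>
    rcases hd' with hd' | hd' | hd' <;> rw [hm, hk, hd'] at hmod <;> omega

end Arithmetic

/-- `α_K` as a real number: the height of the rectangle `R₁`. -/
def alphaReal (D : ℕ) : ℝ := (emb D (alpha D)).2

/-- `-ᾱ_K` as a real number: the width of the rectangle `R₀`. -/
def negAlphaConj (D : ℕ) : ℝ := -(emb D (alpha D)).1

section Lattice

variable {D : ℕ}

lemma sqrtD_sq : sqrtD D ^ 2 = (D : K D) := Subtype.ext (by simp [sqrtD])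

lemma sqrt_mul_self_natCast : √(D : ℝ) * √(D : ℝ) = D := Real.mul_self_sqrt D.cast_nonneg

lemma isIntegral_sqrtD : IsIntegral ℤ (sqrtD D) := by
  refine IsIntegral.of_pow two_pos ?_
  rw [sqrtD_sq]
  simpa using isIntegral_algebraMap (R := ℤ) (A := K D) (x := (D : ℤ))

lemma isIntegral_alpha : IsIntegral ℤ (alpha D) := by
  rw [alpha]
  split_ifs with h1
  · refine ⟨Polynomial.X ^ 2 - Polynomial.X - Polynomial.C ((D / 4 : ℕ) : ℤ), by monicity!, ?_⟩
    have hD4 : sqrtD D ^ 2 = ((4 * (D / 4) + 1 : ℕ) : K D) := by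
      rw [sqrtD_sq]
      congr 1
      omega
    push_cast at hD4
    simp only [Polynomial.eval₂_sub, Polynomial.eval₂_pow, Polynomial.eval₂_X, Polynomial.eval₂_C]
    simp only [eq_intCast, Int.cast_natCast]
    linear_combination hD4 / 4
  · exact isIntegral_sqrtD

lemma exists_eq_add_mul_sqrtD (x : K D) : ∃ r s : ℚ, x = r + s * sqrtD D := by
  have hint : IsIntegral ℚ √(D : ℝ) :=
    ⟨Polynomial.X ^ 2 - Polynomial.C (D : ℚ), Polynomial.monic_X_pow_sub_C _ two_ne_zero, by simp⟩
  have hx : (x : ℝ) ∈ Algebra.adjoin ℚ {√(D : ℝ)} := by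
    rw [← IntermediateField.adjoin_simple_toSubalgebra_of_isAlgebraic hint.isAlgebraic]
    exact x.2
  suffices hreal : ∃ r s : ℚ, (x : ℝ) = r + s * √(D : ℝ) by
    obtain ⟨r, s, h⟩ := hreal
    exact ⟨r, s, Subtype.ext (by rw [h]; simp [sqrtD])⟩
  generalize (x : ℝ) = z at hx
  induction hx using Algebra.adjoin_induction with
  | mem y hy => exact ⟨0, 1, by rw [mem_singleton_iff.1 hy]; simp⟩
  | algebraMap r => exact ⟨r, 0, by simp⟩
  | add y z _ _ hy hz =>
    obtain ⟨⟨r, s, rfl⟩, ⟨r', s', rfl⟩⟩ := And.intro hy hz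
    exact ⟨r + r', s + s', by push_cast; ring⟩
  | mul y z _ _ hy hz =>
    obtain ⟨⟨r, s, rfl⟩, ⟨r', s', rfl⟩⟩ := And.intro hy hz
    refine ⟨r * r' + s * s' * D, r * s' + s * r', ?_⟩
    push_cast
    linear_combination (s * s' : ℝ) * sqrt_mul_self_natCast (D := D)

lemma eq_zero_of_emb_eq_zero {x : K D} (h : (emb D x).1 = 0 ∨ (emb D x).2 = 0) : x = 0 := by
  obtain h | h := h
  · have : algebraMap (K D) ℝ (conj D x) = 0 := h
    rwa [map_eq_zero, map_eq_zero] at this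
  · have : algebraMap (K D) ℝ x = 0 := h
    rwa [map_eq_zero] at this

lemma eq_zero_of_mem_lattice {q : V} (hq : q ∈ lattice D) (h : q.1 = 0 ∨ q.2 = 0) : q = 0 := by
  obtain ⟨z, rfl⟩ := hq
  have hz : z = 0 := by exact_mod_cast eq_zero_of_emb_eq_zero (x := (z : K D)) h
  rw [hz, map_zero]

lemma embO_injective : Function.Injective (embO D) :=
  (emb D).injective.comp NumberField.RingOfIntegers.coe_injective

lemma one_lt_sqrt_natCast (hD : 1 < D) : 1 < √(D : ℝ) := by
  rw [Real.lt_sqrt zero_le_one]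
  exact_mod_cast (by simpa using hD)

variable (hD : 1 < D) (hsq : Squarefree D)
include hD hsq

lemma conj_add_mul_sqrtD (r s : ℚ) : conj D (r + s * sqrtD D) = r - s * sqrtD D := by
  rw [map_add, map_mul, conj_sqrtD D hD hsq, map_ratCast, map_ratCast, mul_neg, sub_eq_add_neg]

lemma emb_add_mul_sqrtD (r s : ℚ) :
    emb D (r + s * sqrtD D) = (r - s * √(D : ℝ), r + s * √(D : ℝ)) := by
  refine Prod.ext ?_ ?_
  · change algebraMap (K D) ℝ (conj D _) = _
    rw [conj_add_mul_sqrtD hD hsq, map_sub, map_mul, map_ratCast, map_ratCast]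
    rfl
  · change algebraMap (K D) ℝ _ = _
    rw [map_add, map_mul, map_ratCast, map_ratCast]
    rfl

lemma alphaReal_negAlphaConj_cases :
    (D % 4 = 1 ∧ alphaReal D = (1 + √(D : ℝ)) / 2 ∧ negAlphaConj D = (√(D : ℝ) - 1) / 2) ∨
    (D % 4 ≠ 1 ∧ alphaReal D = √(D : ℝ) ∧ negAlphaConj D = √(D : ℝ)) := by
  rw [alphaReal, negAlphaConj, alpha]
  split_ifs with h1
  · have halpha : (1 + sqrtD D) / 2 = ((1 / 2 : ℚ) : K D) + ((1 / 2 : ℚ) : K D) * sqrtD D := by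
      push_cast
      ring
    rw [halpha, emb_add_mul_sqrtD hD hsq]
    refine Or.inl ⟨h1, ?_, ?_⟩ <;> push_cast <;> ring
  · have hsqrt : sqrtD D = ((0 : ℚ) : K D) + ((1 : ℚ) : K D) * sqrtD D := by simp
    rw [hsqrt, emb_add_mul_sqrtD hD hsq]
    exact Or.inr ⟨h1, by simp, by simp⟩

lemma one_lt_alphaReal : 1 < alphaReal D := by
  have := one_lt_sqrt_natCast hD
  rcases alphaReal_negAlphaConj_cases hD hsq with ⟨-, h, -⟩ | ⟨-, h, -⟩ <;> rw [h] <;> linarith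

lemma negAlphaConj_pos : 0 < negAlphaConj D := by
  have := one_lt_sqrt_natCast hD
  rcases alphaReal_negAlphaConj_cases hD hsq with ⟨-, -, h⟩ | ⟨-, -, h⟩ <;> rw [h] <;> linarith

lemma exists_trace_norm_alpha : ∃ t n : ℤ, 1 ≤ n ∧
    alphaReal D - negAlphaConj D = t ∧ alphaReal D * negAlphaConj D = n := by
  have hs := sqrt_mul_self_natCast (D := D)
  rcases alphaReal_negAlphaConj_cases hD hsq with ⟨h, h1, h2⟩ | ⟨-, h1, h2⟩
  · have hD4 : (D : ℝ) = ((4 * (D / 4) + 1 : ℕ) : ℝ) := by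
      congr 1
      omega
    push_cast at hD4
    refine ⟨1, (D / 4 : ℕ), by omega, by rw [h1, h2]; push_cast; ring, ?_⟩
    rw [h1, h2, Int.cast_natCast]
    linear_combination hs / 4 + hD4 / 4
  · exact ⟨0, D, by omega, by simp [h1, h2], by simp [h1, h2, hs]⟩

lemma exists_int_trace_norm {r s : ℚ} (h : IsIntegral ℤ ((r : K D) + s * sqrtD D)) :
    ∃ m n : ℤ, 2 * r = m ∧ r ^ 2 - D * s ^ 2 = n := by
  have h' : IsIntegral ℤ ((r : K D) - s * sqrtD D) := by
    rw [← conj_add_mul_sqrtD hD hsq]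
    exact h.map ((conj D : K D →ₐ[ℚ] K D).restrictScalars ℤ)
  have htr : ((2 * r : ℚ) : K D) = r + s * sqrtD D + (r - s * sqrtD D) := by
    push_cast
    ring
  have hnm : ((r ^ 2 - D * s ^ 2 : ℚ) : K D) = (r + s * sqrtD D) * (r - s * sqrtD D) := by
    push_cast
    linear_combination ((s : K D) ^ 2) * sqrtD_sq (D := D)
  obtain ⟨m, hm⟩ := exists_intCast_eq_of_isIntegral (F := K D) (htr ▸ h.add h')
  obtain ⟨n, hn⟩ := exists_intCast_eq_of_isIntegral (F := K D) (hnm ▸ h.mul h')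
  exact ⟨m, n, hm, hn⟩

lemma exists_half_int_coords (q : OK D) : ∃ m k n : ℤ, m ^ 2 - D * k ^ 2 = 4 * n ∧
    embO D q = ((m - k * √(D : ℝ)) / 2, (m + k * √(D : ℝ)) / 2) := by
  obtain ⟨r, s, hrs⟩ := exists_eq_add_mul_sqrtD (q : K D)
  obtain ⟨m, n, hm, hn⟩ := exists_int_trace_norm hD hsq (hrs ▸ q.2 :
    IsIntegral ℤ ((r : K D) + s * sqrtD D))
  obtain ⟨k, hk⟩ := exists_intCast_eq_of_squarefree_mul_sq hsq (t := 2 * s) (n := m ^ 2 - 4 * n) (by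
    push_cast
    rw [← hm, ← hn]
    ring)
  have hmk : (m : ℚ) ^ 2 - D * (k : ℚ) ^ 2 = 4 * n := by
    rw [← hm, ← hn, ← hk]
    ring
  have hmR : (2 : ℝ) * r = m := by exact_mod_cast hm
  have hkR : (2 : ℝ) * s = k := by exact_mod_cast hk
  refine ⟨m, k, n, by exact_mod_cast hmk, ?_⟩
  have hemb : embO D q = (r - s * √(D : ℝ), r + s * √(D : ℝ)) := by
    rw [← emb_add_mul_sqrtD hD hsq, ← hrs]
    rfl
  rw [hemb, ← hmR, ← hkR]
  exact Prod.ext (by ring) (by ring)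

lemma exists_int_coords (q : OK D) :
    ∃ x y : ℤ, embO D q = ((x : ℝ) - y * negAlphaConj D, (x : ℝ) + y * alphaReal D) := by
  obtain ⟨m, k, n, hmk, hq⟩ := exists_half_int_coords hD hsq q
  have h4 : ¬ 4 ∣ D := by
    intro h
    have := Nat.isUnit_iff.1 (hsq 2 (by simpa using h))
    omega
  have hpar := parity_of_sq_sub_mul_sq h4 hmk
  rw [hq]
  rcases alphaReal_negAlphaConj_cases hD hsq with ⟨h1, ha, hb⟩ | ⟨h1, ha, hb⟩
  · rw [if_pos h1] at hpar
    obtain ⟨x, hx⟩ := hpar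
    have hxR : (m : ℝ) - k = x + x := by exact_mod_cast hx
    refine ⟨x, k, ?_⟩
    rw [ha, hb]
    exact Prod.ext (by linear_combination hxR / 2) (by linear_combination hxR / 2)
  · rw [if_neg h1] at hpar
    obtain ⟨⟨x, rfl⟩, y, rfl⟩ := hpar
    refine ⟨x, y, ?_⟩
    rw [ha, hb]
    push_cast
    exact Prod.ext (by ring) (by ring)

lemma mem_lattice_iff {v : V} : v ∈ lattice D ↔
    ∃ x y : ℤ, v = ((x : ℝ) - y * negAlphaConj D, (x : ℝ) + y * alphaReal D) := by
  constructor
  · rintro ⟨q, rfl⟩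
    exact exists_int_coords hD hsq q
  · rintro ⟨x, y, rfl⟩
    let α : OK D := ⟨alpha D, isIntegral_alpha⟩
    have hα : embO D α = (-negAlphaConj D, alphaReal D) := by
      rw [negAlphaConj, neg_neg, alphaReal]
      rfl
    refine ⟨(x : OK D) + (y : OK D) * α, ?_⟩
    change embO D _ = _
    rw [map_add, map_mul, map_intCast, map_intCast, hα]
    exact Prod.ext (by simp [sub_eq_add_neg]) (by simp)

lemma mk_mem_lattice (x y : ℤ) :
    (((x : ℝ) - y * negAlphaConj D, (x : ℝ) + y * alphaReal D) : V) ∈ lattice D :=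
  (mem_lattice_iff hD hsq).2 ⟨x, y, rfl⟩

lemma one_mem_lattice : ((1, 1) : V) ∈ lattice D := by
  simpa using mk_mem_lattice hD hsq 1 0

lemma alpha_mem_lattice : ((-negAlphaConj D, alphaReal D) : V) ∈ lattice D := by
  simpa using mk_mem_lattice hD hsq 0 1

lemma exists_int_norm {q : V} (hq : q ∈ lattice D) : ∃ n : ℤ, q.1 * q.2 = n := by
  obtain ⟨x, y, rfl⟩ := (mem_lattice_iff hD hsq).1 hq
  obtain ⟨t, n, -, ht, hn⟩ := exists_trace_norm_alpha hD hsq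
  refine ⟨x ^ 2 + t * (x * y) - n * y ^ 2, ?_⟩
  push_cast
  rw [← ht, ← hn]
  ring

lemma one_le_absNorm {q : V} (hq : q ∈ lattice D) (h0 : q ≠ 0) : 1 ≤ absNorm q := by
  obtain ⟨n, hn⟩ := exists_int_norm hD hsq hq
  rw [absNorm, hn]
  have hn0 : n ≠ 0 := by
    rintro rfl
    rw [Int.cast_zero, mul_eq_zero] at hn
    exact h0 (eq_zero_of_mem_lattice hq hn)
  exact_mod_cast Int.one_le_abs hn0

lemma eq_zero_of_absNorm_lt_one {q : V} (hq : q ∈ lattice D) (h : absNorm q < 1) : q = 0 := by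
  by_contra h0
  exact (one_le_absNorm hD hsq hq h0).not_gt h

lemma finite_lattice_inter_closedBall (R : ℝ) :
    ((lattice D : Set V) ∩ Metric.closedBall 0 R).Finite := by
  have ha := one_lt_alphaReal hD hsq
  have hb := negAlphaConj_pos hD hsq
  obtain ⟨N, hN⟩ := exists_nat_ge (R + 2 * R * alphaReal D + 2 * R)
  refine ((finite_Icc (-(N : ℤ)) N).prod (finite_Icc (-(N : ℤ)) N)).image (fun p : ℤ × ℤ =>
    (((p.1 : ℝ) - p.2 * negAlphaConj D, (p.1 : ℝ) + p.2 * alphaReal D) : V)) |>.subset ?_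
  rintro q ⟨hq, hqR⟩
  obtain ⟨x, y, rfl⟩ := (mem_lattice_iff hD hsq).1 hq
  rw [mem_closedBall_zero_iff, Prod.norm_mk, max_le_iff, Real.norm_eq_abs, Real.norm_eq_abs]
    at hqR
  obtain ⟨hs, hu⟩ := hqR
  have hR : 0 ≤ R := (abs_nonneg _).trans hs
  have hRa : 0 ≤ 2 * R * alphaReal D := by positivity
  have hy : |(y : ℝ)| ≤ 2 * R := by
    rw [abs_le] at hs hu ⊢
    constructor <;> by_contra! <;> nlinarith
  have hx : |(x : ℝ)| ≤ R + 2 * R * alphaReal D := by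
    rw [abs_le] at hu hy ⊢
    constructor <;> nlinarith
  rw [abs_le] at hx hy
  refine ⟨(x, y), ⟨⟨?_, ?_⟩, ⟨?_, ?_⟩⟩, rfl⟩ <;> rify <;> linarith

end Lattice

/-! ### The unit `ε` and its flow on the plane -/

/-- The unit `ε` as a real number: the unstable multiplier of `φ`. -/
def epsReal (D : ℕ) (ε : (OK D)ˣ) : ℝ := (embO D (ε : OK D)).2

/-- The conjugate `ε̄` as a real number: the stable multiplier of `φ`. -/
def epsConj (D : ℕ) (ε : (OK D)ˣ) : ℝ := (embO D (ε : OK D)).1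

section Unit

variable {D : ℕ} {ε : (OK D)ˣ}

lemma epsReal_pos (he : 1 < epsReal D ε) : 0 < epsReal D ε := zero_lt_one.trans he

lemma embO_zpow_snd (n : ℤ) : (embO D ((ε ^ n : (OK D)ˣ) : OK D)).2 = epsReal D ε ^ n := by
  let g : OK D →* ℝ := ((RingHom.snd ℝ ℝ).comp (embO D) : OK D →+* ℝ)
  have h : ((Units.map g (ε ^ n) : ℝˣ) : ℝ) = ((Units.map g ε) ^ n : ℝˣ) := by rw [map_zpow]
  rwa [Units.val_zpow_eq_zpow_val] at h

lemma le_of_add_le_add_inv_of_one_le_mul {a b c : ℝ} (hc : 1 < c) (hadd : a + b ≤ c + c⁻¹)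
    (hmul : 1 ≤ a * b) : a ≤ c := by
  have hcc : c * c⁻¹ = 1 := mul_inv_cancel₀ (by positivity)
  have hc1 : c⁻¹ < 1 := inv_lt_one_of_one_lt₀ hc
  have hprod : 0 ≤ (a - c) * (b - c) := by nlinarith
  by_contra! hac
  have hbc : c ≤ b := by
    by_contra!
    nlinarith
  linarith

section

variable (hD : 1 < D) (hsq : Squarefree D)
include hD hsq

lemma epsConj_mul_epsReal : epsConj D ε * epsReal D ε = 1 ∨ epsConj D ε * epsReal D ε = -1 := by
  have hinv : embO D (ε : OK D) * embO D ((ε⁻¹ : (OK D)ˣ) : OK D) = 1 := by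
    rw [← map_mul, Units.mul_inv, map_one]
  obtain ⟨m, hm⟩ := exists_int_norm hD hsq (q := embO D (ε : OK D)) ⟨_, rfl⟩
  obtain ⟨n, hn⟩ := exists_int_norm hD hsq (q := embO D ((ε⁻¹ : (OK D)ˣ) : OK D)) ⟨_, rfl⟩
  have hmn : (m : ℝ) * n = 1 := by
    rw [← hm, ← hn, mul_mul_mul_comm, ← Prod.fst_mul, ← Prod.snd_mul, hinv, Prod.fst_one,
      Prod.snd_one, mul_one]
  rw [epsConj, epsReal, hm]
  rcases Int.isUnit_iff.1 (IsUnit.of_mul_eq_one n (by exact_mod_cast hmn)) with rfl | rfl <;> simp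

lemma abs_epsConj_mul_epsReal : |epsConj D ε * epsReal D ε| = 1 := by
  rcases epsConj_mul_epsReal hD hsq (ε := ε) with h | h <;> rw [h] <;> simp

lemma abs_epsConj (he : 1 < epsReal D ε) : |epsConj D ε| = (epsReal D ε)⁻¹ := by
  refine eq_inv_of_mul_eq_one_left ?_
  rw [← abs_epsConj_mul_epsReal hD hsq (ε := ε), abs_mul, abs_of_pos (epsReal_pos he)]

lemma epsConj_ne_zero (he : 1 < epsReal D ε) : epsConj D ε ≠ 0 := by
  rw [← abs_pos, abs_epsConj hD hsq he]
  exact inv_pos.2 (epsReal_pos he)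

lemma abs_epsConj_lt_one (he : 1 < epsReal D ε) : |epsConj D ε| < 1 := by
  rw [abs_epsConj hD hsq he]
  exact inv_lt_one_of_one_lt₀ he

lemma one_le_alphaReal_mul_negAlphaConj : 1 ≤ alphaReal D * negAlphaConj D := by
  obtain ⟨t, n, hn1, -, hn⟩ := exists_trace_norm_alpha hD hsq
  rw [hn]
  exact_mod_cast hn1

lemma alphaReal_add_negAlphaConj_le (he : 1 < epsReal D ε) :
    alphaReal D + negAlphaConj D ≤ epsReal D ε - epsConj D ε := by
  have hpos : 0 < alphaReal D + negAlphaConj D := by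
    linarith [one_lt_alphaReal hD hsq, negAlphaConj_pos hD hsq]
  obtain ⟨x, y, hxy⟩ := exists_int_coords hD hsq (ε : OK D)
  have heq : epsReal D ε - epsConj D ε = y * (alphaReal D + negAlphaConj D) := by
    rw [epsReal, epsConj, hxy]
    ring
  have hlt : 0 < epsReal D ε - epsConj D ε := by
    linarith [(abs_lt.1 (abs_epsConj_lt_one hD hsq he)).2]
  have hy : (1 : ℝ) ≤ y := by
    exact_mod_cast (pos_of_mul_pos_left (heq ▸ hlt) hpos.le : (0 : ℝ) < y)
  rw [heq]
  exact le_mul_of_one_le_left hpos.le hy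

lemma alphaReal_add_negAlphaConj_le_add_inv (he : 1 < epsReal D ε) :
    alphaReal D + negAlphaConj D ≤ epsReal D ε + (epsReal D ε)⁻¹ := by
  rw [← abs_epsConj hD hsq he]
  linarith [alphaReal_add_negAlphaConj_le hD hsq he, neg_abs_le (epsConj D ε)]

lemma alphaReal_le_epsReal (he : 1 < epsReal D ε) : alphaReal D ≤ epsReal D ε :=
  le_of_add_le_add_inv_of_one_le_mul he (alphaReal_add_negAlphaConj_le_add_inv hD hsq he)
    (one_le_alphaReal_mul_negAlphaConj hD hsq)

lemma negAlphaConj_le_epsReal (he : 1 < epsReal D ε) : negAlphaConj D ≤ epsReal D ε := by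
  refine le_of_add_le_add_inv_of_one_le_mul he ?_
    ((one_le_alphaReal_mul_negAlphaConj hD hsq).trans_eq (mul_comm _ _))
  rw [add_comm]
  exact alphaReal_add_negAlphaConj_le_add_inv hD hsq he

end

lemma golden_ratio_of_eq_five :
    alphaReal 5 * negAlphaConj 5 = 1 ∧ alphaReal 5 - negAlphaConj 5 = 1 := by
  obtain ⟨-, ha, hb⟩ | ⟨h, -, -⟩ :=
    alphaReal_negAlphaConj_cases (by norm_num) Nat.prime_five.squarefree
  · have hs := sqrt_mul_self_natCast (D := 5)
    push_cast at hs
    rw [ha, hb]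
    push_cast
    exact ⟨by linear_combination hs / 4, by ring⟩
  · exact absurd rfl h

lemma exists_unit_eq_alphaReal_of_eq_five : ∃ u : (OK 5)ˣ, (embO 5 (u : OK 5)).2 = alphaReal 5 := by
  obtain ⟨hmul, hsub⟩ := golden_ratio_of_eq_five
  let α : OK 5 := ⟨alpha 5, isIntegral_alpha⟩
  have hemb : embO 5 α = (-negAlphaConj 5, alphaReal 5) := by
    rw [negAlphaConj, neg_neg, alphaReal]
    rfl
  have hα : α * (α - 1) = 1 := by
    apply embO_injective
    rw [map_mul, map_sub, map_one, hemb]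
    refine Prod.ext ?_ ?_
    · simp only [Prod.fst_mul, Prod.fst_sub, Prod.fst_one]
      linear_combination hmul - negAlphaConj 5 * hsub
    · simp only [Prod.snd_mul, Prod.snd_sub, Prod.snd_one]
      linear_combination hmul + alphaReal 5 * hsub
  exact ⟨⟨α, α - 1, hα, by rw [mul_comm, hα]⟩, show (embO 5 α).2 = _ by rw [hemb]⟩

lemma epsReal_eq_alphaReal_of_eq_five {ε : (OK 5)ˣ} (hε : IsFundamentalUnit 5 ε) :
    epsReal 5 ε = alphaReal 5 := by
  have he : 1 < epsReal 5 ε := hε.1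
  have hone : 1 < alphaReal 5 := one_lt_alphaReal (by norm_num) Nat.prime_five.squarefree
  refine le_antisymm ?_ (alphaReal_le_epsReal (by norm_num) Nat.prime_five.squarefree he)
  obtain ⟨u, hu⟩ := exists_unit_eq_alphaReal_of_eq_five
  obtain ⟨n, hn⟩ := hε.2 u
  have hpow : epsReal 5 ε ^ n = alphaReal 5 := by
    rcases hn with rfl | rfl
    · rw [← hu, embO_zpow_snd]
    · rw [Units.val_neg, map_neg, Prod.snd_neg, embO_zpow_snd] at hu
      linarith [zpow_pos (epsReal_pos he) n]
  have hn1 : 1 ≤ n := (one_lt_zpow_iff_right₀ he).1 (hpow ▸ hone)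
  calc epsReal 5 ε = epsReal 5 ε ^ (1 : ℤ) := (zpow_one _).symm
    _ ≤ epsReal 5 ε ^ n := zpow_le_zpow_right₀ he.le hn1
    _ = alphaReal 5 := hpow

/-- The flow `(s, u) ↦ (ε̄ⁱ s, εⁱ u)` on the plane, whose time-one map lifts `φ`. -/
def flow (D : ℕ) (ε : (OK D)ˣ) (i : ℤ) (v : V) : V := (epsConj D ε ^ i * v.1, epsReal D ε ^ i * v.2)

lemma flow_zero (v : V) : flow D ε 0 v = v := by simp [flow]

lemma flow_sub (i : ℤ) (v w : V) : flow D ε i (v - w) = flow D ε i v - flow D ε i w := by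
  simp [flow, mul_sub]

lemma flow_add (i : ℤ) (v w : V) : flow D ε i (v + w) = flow D ε i v + flow D ε i w := by
  simp [flow, mul_add]

lemma proj_eq_iff {v w : V} : proj D v = proj D w ↔ v - w ∈ lattice D := by
  change (v : V ⧸ lattice D) = (w : V ⧸ lattice D) ↔ _
  rw [QuotientAddGroup.eq, ← (lattice D).neg_mem_iff, neg_add, neg_neg, sub_eq_add_neg]

lemma proj_eq_zero_iff {v : V} : proj D v = proj D 0 ↔ v ∈ lattice D := by
  rw [proj_eq_iff, sub_zero]

lemma phi_proj (v : V) : phi D ε (proj D v) = proj D (flow D ε 1 v) := by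
  change proj D (phiV D ε v) = _
  rw [flow, zpow_one, zpow_one]
  rfl

lemma mem_range_emb_of_periodic (he : 1 < epsReal D ε) {n : ℕ} (hn : n ≠ 0) {v : V}
    (h : flow D ε n v - v ∈ lattice D) : v ∈ range (emb D) := by
  obtain ⟨q, hq⟩ := h
  let z : K D := ((ε : OK D) : K D) ^ n - 1
  have hz : emb D z = (epsConj D ε ^ n - 1, epsReal D ε ^ n - 1) := by
    rw [map_sub, map_pow, map_one]
    rfl
  have hzv : emb D z * v = emb D q := by
    refine Eq.trans ?_ hq.symm
    rw [hz]
    refine Prod.ext ?_ ?_ <;> simp [flow, sub_mul]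
  have hz0 : z ≠ 0 := by
    intro h0
    have hsnd : epsReal D ε ^ n - 1 = 0 := by
      rw [h0, map_zero] at hz
      exact (congrArg Prod.snd hz).symm
    linarith [one_lt_pow₀ he hn]
  refine ⟨z⁻¹ * (q : K D), ?_⟩
  rw [map_mul, ← hzv, ← mul_assoc, ← map_mul, inv_mul_cancel₀ hz0, map_one, one_mul]

variable (hD : 1 < D) (hsq : Squarefree D)
include hD hsq

lemma absNorm_flow (i : ℤ) (v : V) : absNorm (flow D ε i v) = absNorm v := by
  rw [absNorm, absNorm, flow, mul_mul_mul_comm, ← mul_zpow, abs_mul, abs_zpow,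
    abs_epsConj_mul_epsReal hD hsq, one_zpow, one_mul]

lemma flow_flow (he : 1 < epsReal D ε) (i j : ℤ) (v : V) :
    flow D ε i (flow D ε j v) = flow D ε (i + j) v := by
  rw [flow, flow, flow, zpow_add₀ (epsConj_ne_zero hD hsq he), zpow_add₀ (epsReal_pos he).ne',
    mul_assoc, mul_assoc]

lemma phi_zpow_proj (he : 1 < epsReal D ε) (i : ℤ) (v : V) :
    (phi D ε ^ i) (proj D v) = proj D (flow D ε i v) := by
  induction i with
  | zero => simp [flow_zero]
  | succ n ih =>
    rw [add_comm, zpow_add, Equiv.Perm.mul_apply, ih, zpow_one, phi_proj, flow_flow hD hsq he]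
  | pred n ih =>
    rw [sub_eq_add_neg, add_comm, zpow_add, Equiv.Perm.mul_apply, ih, zpow_neg_one,
      Equiv.Perm.inv_eq_iff_eq, phi_proj, flow_flow hD hsq he, add_neg_cancel_left]

lemma flow_mem_lattice (he : 1 < epsReal D ε) (i : ℤ) {q : V} (hq : q ∈ lattice D) :
    flow D ε i q ∈ lattice D := by
  rw [← proj_eq_zero_iff, ← phi_zpow_proj hD hsq he, proj_eq_zero_iff.2 hq,
    phi_zpow_proj hD hsq he]
  exact congrArg (proj D) (Prod.ext (mul_zero _) (mul_zero _))

end Unit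

/-! ### Tiling of the plane by the footprint -/

lemma int_trichotomy (x : ℤ) : (x : ℝ) ≤ -1 ∨ x = 0 ∨ (1 : ℝ) ≤ x := by
  have h : x ≤ -1 ∨ x = 0 ∨ 1 ≤ x := by omega
  exact_mod_cast h

lemma int_trichotomy_mul (y : ℤ) {a b : ℝ} (ha : 0 < a) (hb : 0 < b) :
    ((y : ℝ) * a ≤ -a ∧ (y : ℝ) * b ≤ -b) ∨ y = 0 ∨ (a ≤ y * a ∧ b ≤ y * b) := by
  rcases int_trichotomy y with h | h | h
  · exact Or.inl ⟨by nlinarith, by nlinarith⟩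
  · exact Or.inr (Or.inl h)
  · exact Or.inr (Or.inr ⟨by nlinarith, by nlinarith⟩)

/-- The left ends of the rectangles `planeR D i`. -/
def sLo : Fin 2 → ℝ := ![0, -1]

/-- The right ends of the rectangles `planeR D i`. -/
def sHi (D : ℕ) : Fin 2 → ℝ := ![negAlphaConj D, 0]

/-- The upper ends of the rectangles `planeR D i`. -/
def uHi (D : ℕ) : Fin 2 → ℝ := ![1, alphaReal D]

/-- The closure of the footprint, as an explicit union of closed rectangles. -/
def closedFootprint (D : ℕ) : Set V :=
  Icc 0 (negAlphaConj D) ×ˢ Icc 0 1 ∪ Icc (-1) 0 ×ˢ Icc 0 (alphaReal D)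

/-- The points of the plane having no coordinate in common with a lattice point. -/
def Generic (D : ℕ) (v : V) : Prop := ∀ r ∈ lattice D, v.1 ≠ r.1 ∧ v.2 ≠ r.2

section Tiling

variable {D : ℕ}

lemma planeR_eq (i : Fin 2) : planeR D i = Ioo (sLo i) (sHi D i) ×ˢ Ioo 0 (uHi D i) := by
  fin_cases i <;> rfl

lemma mem_planeR_zero {v : V} :
    v ∈ planeR D 0 ↔ (0 < v.1 ∧ v.1 < negAlphaConj D) ∧ 0 < v.2 ∧ v.2 < 1 := Iff.rfl

lemma mem_planeR_one {v : V} :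
    v ∈ planeR D 1 ↔ (-1 < v.1 ∧ v.1 < 0) ∧ 0 < v.2 ∧ v.2 < alphaReal D := Iff.rfl

lemma mem_footprint_iff {v : V} : v ∈ footprint D ↔ ∃ i, v ∈ planeR D i := by
  simp [footprint, Fin.exists_fin_two]

lemma planeR_subset_footprint (i : Fin 2) : planeR D i ⊆ footprint D :=
  fun _ hv => mem_footprint_iff.2 ⟨i, hv⟩

lemma footprint_subset_closedFootprint : footprint D ⊆ closedFootprint D :=
  union_subset_union (prod_mono Ioo_subset_Icc_self Ioo_subset_Icc_self)
    (prod_mono Ioo_subset_Icc_self Ioo_subset_Icc_self)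

lemma isCompact_closedFootprint : IsCompact (closedFootprint D) :=
  (isCompact_Icc.prod isCompact_Icc).union (isCompact_Icc.prod isCompact_Icc)

lemma Generic.sub {v q : V} (hv : Generic D v) (hq : q ∈ lattice D) : Generic D (v - q) :=
  fun _ hr => (hv _ ((lattice D).add_mem hr hq)).imp (fun h => h ∘ sub_eq_iff_eq_add.1)
    (fun h => h ∘ sub_eq_iff_eq_add.1)

variable (hD : 1 < D) (hsq : Squarefree D)
include hD hsq

lemma eq_of_mem_planeR_of_sub_mem_lattice {i j : Fin 2} {v w : V} (hv : v ∈ planeR D i)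
    (hw : w ∈ planeR D j) (h : v - w ∈ lattice D) : v = w ∧ i = j := by
  have ha := one_lt_alphaReal hD hsq
  have hb := negAlphaConj_pos hD hsq
  obtain ⟨x, y, hxy⟩ := (mem_lattice_iff hD hsq).1 h
  have hs : v.1 - w.1 = x - y * negAlphaConj D := congrArg Prod.fst hxy
  have hu : v.2 - w.2 = x + y * alphaReal D := congrArg Prod.snd hxy
  suffices hsuff : (x = 0 ∧ y = 0) ∧ i = j by
    obtain ⟨⟨rfl, rfl⟩, hij⟩ := hsuff
    exact ⟨sub_eq_zero.1 (hxy.trans (by simp)), hij⟩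
  have hy := int_trichotomy_mul y (zero_lt_one.trans ha) hb
  have hx := int_trichotomy x
  fin_cases i <;> fin_cases j <;> simp only [Fin.zero_eta, Fin.mk_one] at hv hw <;>
    simp only [mem_planeR_zero, mem_planeR_one] at hv hw <;>
    rcases hx with hx | rfl | hx <;> rcases hy with ⟨hya, hyb⟩ | rfl | ⟨hya, hyb⟩ <;>
    first
    | exact ⟨⟨rfl, rfl⟩, rfl⟩
    | (exfalso; push_cast at hs hu; linarith)

lemma notMem_planeR_of_vertical {i : Fin 2} {v r : V} (hr : r ∈ lattice D) (hs : v.1 = r.1)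
    (hu : v.2 - r.2 ∈ Icc 0 (1 + alphaReal D)) : v ∉ planeR D i := by
  intro hv
  have ha := one_lt_alphaReal hD hsq
  have hb := negAlphaConj_pos hD hsq
  obtain ⟨x, y, rfl⟩ := (mem_lattice_iff hD hsq).1 hr
  obtain ⟨hu0, hu1⟩ := hu
  have hy := int_trichotomy_mul y (zero_lt_one.trans ha) hb
  have hx := int_trichotomy x
  fin_cases i <;> simp only [Fin.zero_eta, Fin.mk_one] at hv <;>
    simp only [mem_planeR_zero, mem_planeR_one] at hv <;>
    rcases hx with hx | rfl | hx <;> rcases hy with ⟨hya, hyb⟩ | rfl | ⟨hya, hyb⟩ <;>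
    push_cast at hs hu0 hu1 <;> linarith

lemma notMem_planeR_of_horizontal {i : Fin 2} {v r : V} (hr : r ∈ lattice D) (hu : v.2 = r.2)
    (hs : v.1 - r.1 ∈ Icc (-1) (negAlphaConj D)) : v ∉ planeR D i := by
  intro hv
  have ha := one_lt_alphaReal hD hsq
  have hb := negAlphaConj_pos hD hsq
  obtain ⟨x, y, rfl⟩ := (mem_lattice_iff hD hsq).1 hr
  obtain ⟨hs0, hs1⟩ := hs
  have hy := int_trichotomy_mul y (zero_lt_one.trans ha) hb
  have hx := int_trichotomy x
  fin_cases i <;> simp only [Fin.zero_eta, Fin.mk_one] at hv <;>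
    simp only [mem_planeR_zero, mem_planeR_one] at hv <;>
    rcases hx with hx | rfl | hx <;> rcases hy with ⟨hya, hyb⟩ | rfl | ⟨hya, hyb⟩ <;>
    push_cast at hu hs0 hs1 <;> linarith

lemma exists_sub_mem_strip (v : V) :
    ∃ q ∈ lattice D, v - q ∈ Icc (-1) (negAlphaConj D) ×ˢ Ici (0 : ℝ) := by
  have ha := one_lt_alphaReal hD hsq
  have hb := negAlphaConj_pos hD hsq
  have hab : 0 < alphaReal D + negAlphaConj D := by linarith
  obtain ⟨n, hn⟩ := exists_nat_ge ((v.1 - v.2 + 1) / (alphaReal D + negAlphaConj D))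
  rw [div_le_iff₀ hab] at hn
  have hfl := Int.floor_le (v.1 - n * negAlphaConj D)
  have hlt := Int.lt_floor_add_one (v.1 - n * negAlphaConj D)
  refine ⟨_, mk_mem_lattice hD hsq (⌊v.1 - n * negAlphaConj D⌋ + 1) (-n), ⟨?_, ?_⟩, ?_⟩ <;>
    simp only [Prod.fst_sub, Prod.snd_sub, mem_Ici] <;> push_cast <;> linarith

lemma finite_lattice_sub_mem {B : Set V} (hB : Bornology.IsBounded B) (v : V) :
    {q ∈ (lattice D : Set V) | v - q ∈ B}.Finite := by
  obtain ⟨R, hR⟩ := hB.exists_norm_le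
  refine (finite_lattice_inter_closedBall hD hsq (‖v‖ + R)).subset fun q hq => ⟨hq.1, ?_⟩
  rw [mem_closedBall_zero_iff, ← sub_sub_cancel v q]
  exact (norm_sub_le _ _).trans (by linarith [hR _ hq.2])

-- Lower a translate of `v` in the strip by `(1, 1)` or `(ᾱ, α)` as long as it stays in the strip.
lemma exists_sub_mem_closedFootprint (v : V) : ∃ q ∈ lattice D, v - q ∈ closedFootprint D := by
  have ha := one_lt_alphaReal hD hsq
  have hb := negAlphaConj_pos hD hsq
  obtain ⟨q₀, hq₀, hs₀, hu₀⟩ := exists_sub_mem_strip hD hsq v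
  have hfin := finite_lattice_sub_mem hD hsq (v := v)
    ((Metric.isBounded_Icc (-1) (negAlphaConj D)).prod (Metric.isBounded_Icc 0 (v - q₀).2))
  obtain ⟨q, ⟨hq, hs, hu⟩, hmin⟩ :=
    exists_min_image _ (fun q : V => (v - q).2) hfin ⟨q₀, hq₀, hs₀, hu₀, le_rfl⟩
  have hlow : ∀ r ∈ lattice D, (v - (q + r)).1 ∈ Icc (-1) (negAlphaConj D) → 0 < r.2 →
      (v - (q + r)).2 < 0 := by
    intro r hr hsr hpos
    by_contra! hur
    have hlt : (v - (q + r)).2 < (v - q).2 := by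
      simp only [Prod.snd_sub, Prod.snd_add]
      linarith
    exact (hmin _ ⟨(lattice D).add_mem hq hr, hsr, hur, hlt.le.trans hu.2⟩).not_gt hlt
  have h1 := hlow _ (one_mem_lattice hD hsq)
  have hα := hlow _ (alpha_mem_lattice hD hsq)
  simp only [Prod.fst_sub, Prod.snd_sub, Prod.fst_add, Prod.snd_add, mem_Icc] at h1 hα hs hu
  refine ⟨q, hq, ?_⟩
  rcases le_total (v - q).1 0 with h | h
  · refine Or.inr ⟨⟨hs.1, h⟩, hu.1, ?_⟩
    simp only [Prod.fst_sub, Prod.snd_sub] at h ⊢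
    linarith [hα ⟨by linarith, by linarith⟩ (by linarith)]
  · refine Or.inl ⟨⟨h, hs.2⟩, hu.1, ?_⟩
    simp only [Prod.fst_sub, Prod.snd_sub] at h ⊢
    linarith [h1 ⟨by linarith, by linarith⟩ one_pos]

lemma exists_mem_closedFootprint_proj_eq (x : Torus D) :
    ∃ v ∈ closedFootprint D, proj D v = x := by
  obtain ⟨v, rfl⟩ : ∃ v, proj D v = x := Quotient.exists_rep x
  obtain ⟨q, hq, hvq⟩ := exists_sub_mem_closedFootprint hD hsq v
  refine ⟨v - q, hvq, ?_⟩
  rw [proj_eq_iff, sub_sub_cancel_left]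
  exact (lattice D).neg_mem hq

lemma norm_le_of_mem_closedFootprint {v : V} (hv : v ∈ closedFootprint D) :
    ‖v‖ ≤ 1 + alphaReal D + negAlphaConj D := by
  have ha := one_lt_alphaReal hD hsq
  have hb := negAlphaConj_pos hD hsq
  rw [Prod.norm_def, max_le_iff, Real.norm_eq_abs, Real.norm_eq_abs, abs_le, abs_le]
  rcases hv with ⟨⟨hs0, hs1⟩, hu0, hu1⟩ | ⟨⟨hs0, hs1⟩, hu0, hu1⟩ <;>
    refine ⟨⟨?_, ?_⟩, ?_, ?_⟩ <;> linarith

lemma closedFootprint_subset_closure : closedFootprint D ⊆ closure (footprint D) := by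
  have ha := one_lt_alphaReal hD hsq
  have hb := negAlphaConj_pos hD hsq
  rw [footprint, closure_union]
  refine union_subset_union ?_ ?_
  · change _ ⊆ closure (Ioo 0 (negAlphaConj D) ×ˢ Ioo 0 1)
    rw [closure_prod_eq, closure_Ioo hb.ne, closure_Ioo zero_ne_one]
  · change _ ⊆ closure (Ioo (-1) 0 ×ˢ Ioo 0 (alphaReal D))
    rw [closure_prod_eq, closure_Ioo (by norm_num), closure_Ioo (by linarith)]

-- The boundary of the closed footprint lies on horizontal and vertical lines through `0`,
-- `±(1, 1)` and `±(ᾱ, α)`.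
lemma Generic.mem_footprint {v : V} (hv : Generic D v) (h : v ∈ closedFootprint D) :
    v ∈ footprint D := by
  have h0 := hv 0 (lattice D).zero_mem
  have h1 := hv _ (one_mem_lattice hD hsq)
  have h1' := hv _ ((lattice D).neg_mem (one_mem_lattice hD hsq))
  have hα := hv _ (alpha_mem_lattice hD hsq)
  have hα' := hv _ ((lattice D).neg_mem (alpha_mem_lattice hD hsq))
  simp only [Prod.neg_mk, neg_neg] at h1' hα'
  rcases h with ⟨⟨hs0, hs1⟩, hu0, hu1⟩ | ⟨⟨hs0, hs1⟩, hu0, hu1⟩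
  · exact Or.inl ⟨⟨hs0.lt_of_ne' h0.1, hs1.lt_of_ne hα'.1⟩, hu0.lt_of_ne' h0.2, hu1.lt_of_ne h1.2⟩
  · exact Or.inr ⟨⟨hs0.lt_of_ne' h1'.1, hs1.lt_of_ne h0.1⟩, hu0.lt_of_ne' h0.2, hu1.lt_of_ne hα.2⟩

lemma Generic.exists_sub_mem {v : V} (hv : Generic D v) :
    ∃ q ∈ lattice D, v - q ∈ footprint D := by
  obtain ⟨q, hq, h⟩ := exists_sub_mem_closedFootprint hD hsq v
  exact ⟨q, hq, (hv.sub hq).mem_footprint hD hsq h⟩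

lemma Generic.flow {ε : (OK D)ˣ} (he : 1 < epsReal D ε) {v : V} (hv : Generic D v) (i : ℤ) :
    Generic D (flow D ε i v) := by
  intro r hr
  obtain ⟨hs, hu⟩ := hv _ (flow_mem_lattice hD hsq he (-i) hr)
  have hflow : RealQuad.flow D ε i (RealQuad.flow D ε (-i) r) = r := by
    rw [flow_flow hD hsq he, add_neg_cancel, flow_zero]
  rw [← hflow]
  exact ⟨fun h => hs (mul_left_cancel₀ (zpow_ne_zero i (epsConj_ne_zero hD hsq he)) h),
    fun h => hu (mul_left_cancel₀ (zpow_ne_zero i (epsReal_pos he).ne') h)⟩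

lemma countable_lattice : (lattice D : Set V).Countable := by
  refine (countable_range fun p : ℤ × ℤ =>
    (((p.1 : ℝ) - p.2 * negAlphaConj D, (p.1 : ℝ) + p.2 * alphaReal D) : V)).mono fun q hq => ?_
  obtain ⟨x, y, rfl⟩ := (mem_lattice_iff hD hsq).1 hq
  exact ⟨(x, y), rfl⟩

lemma dense_generic : Dense {v : V | Generic D v} := by
  have hc := countable_lattice hD hsq
  refine (((hc.image Prod.fst).dense_compl ℝ).prod ((hc.image Prod.snd).dense_compl ℝ)).mono ?_
  rintro v ⟨hs, hu⟩ r hr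
  exact ⟨fun h => hs ⟨r, hr, h.symm⟩, fun h => hu ⟨r, hr, h.symm⟩⟩

end Tiling

/-! ### The Markov property -/

lemma exists_eq_endpoint {f : ℝ → ℝ} (hf : Continuous f) {c d p r x y : ℝ} (hx : x ∈ Ioo c d)
    (hy : y ∈ Ioo c d) (hfx : f x ∈ Ioo p r) (hfy : f y ∉ Ioo p r) :
    ∃ z ∈ Ioo c d, f z = p ∨ f z = r := by
  have hsub : uIcc x y ⊆ Ioo c d := ordConnected_Ioo.uIcc_subset hx hy
  have hiv := intermediate_value_uIcc (a := x) (b := y) hf.continuousOn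
  rcases le_or_gt (f y) p with h | h
  · obtain ⟨z, hz, hzp⟩ := hiv (mem_uIcc.2 (Or.inr ⟨h, hfx.1.le⟩))
    exact ⟨z, hsub hz, Or.inl hzp⟩
  · obtain ⟨z, hz, hzp⟩ := hiv (mem_uIcc.2 (Or.inl ⟨hfx.2.le, not_lt.1 fun hr => hfy ⟨h, hr⟩⟩))
    exact ⟨z, hsub hz, Or.inr hzp⟩

section Markov

variable {D : ℕ} {ε : (OK D)ˣ} (hD : 1 < D) (hsq : Squarefree D) (he : 1 < epsReal D ε)
include hD hsq

lemma sLo_lt_sHi (i : Fin 2) : sLo i < sHi D i := by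
  fin_cases i
  · exact negAlphaConj_pos hD hsq
  · exact neg_one_lt_zero

lemma uHi_pos (i : Fin 2) : 0 < uHi D i := by
  fin_cases i
  · exact one_pos
  · exact zero_lt_one.trans (one_lt_alphaReal hD hsq)

lemma exists_lattice_vertical_edge (i : Fin 2) {v : V} (hs : v.1 = sLo i ∨ v.1 = sHi D i)
    (hu : v.2 ∈ Ioo 0 (uHi D i)) :
    ∃ q ∈ lattice D, v.1 = q.1 ∧ v.2 - q.2 ∈ Icc 0 (1 + alphaReal D) := by
  have ha := one_lt_alphaReal hD hsq
  have hα := (lattice D).neg_mem (alpha_mem_lattice hD hsq)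
  have h1 := (lattice D).neg_mem (one_mem_lattice hD hsq)
  rw [Prod.neg_mk, neg_neg] at hα
  rw [Prod.neg_mk] at h1
  obtain ⟨hu0, hu1⟩ := hu
  fin_cases i
  · change v.2 < 1 at hu1
    rcases hs with h | h
    · exact ⟨0, (lattice D).zero_mem, h, by simp; linarith, by simp; linarith⟩
    · exact ⟨_, hα, h, by simp; linarith, by simp; linarith⟩
  · change v.2 < alphaReal D at hu1
    rcases hs with h | h
    · exact ⟨_, h1, h, by simp; linarith, by simp; linarith⟩
    · exact ⟨0, (lattice D).zero_mem, h, by simp; linarith, by simp; linarith⟩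

lemma exists_lattice_horizontal_edge (i : Fin 2) {v : V} (hs : v.1 ∈ Ioo (sLo i) (sHi D i))
    (hu : v.2 = 0 ∨ v.2 = uHi D i) :
    ∃ q ∈ lattice D, v.2 = q.2 ∧ v.1 - q.1 ∈ Icc (-1) (negAlphaConj D) := by
  have hb := negAlphaConj_pos hD hsq
  obtain ⟨hs0, hs1⟩ := hs
  fin_cases i
  · change 0 < v.1 at hs0
    change v.1 < negAlphaConj D at hs1
    rcases hu with h | h
    · exact ⟨0, (lattice D).zero_mem, h, by simp; linarith, by simp; linarith⟩
    · exact ⟨_, one_mem_lattice hD hsq, h, by simp; linarith, by simp; linarith⟩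
  · change -1 < v.1 at hs0
    change v.1 < 0 at hs1
    rcases hu with h | h
    · exact ⟨0, (lattice D).zero_mem, h, by simp; linarith, by simp; linarith⟩
    · exact ⟨_, alpha_mem_lattice hD hsq, h, by simp; linarith, by simp; linarith⟩

include he

lemma epsConj_mul_mem {s : ℝ} (hs : s ∈ Icc (-1) (negAlphaConj D)) :
    epsConj D ε * s ∈ Icc (-1) (negAlphaConj D) := by
  obtain ⟨hs0, hs1⟩ := hs
  have hb := negAlphaConj_pos hD hsq
  have hpos := epsReal_pos he
  have hlt := abs_epsConj_lt_one hD hsq he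
  have hmul : |epsConj D ε| * negAlphaConj D ≤ 1 := by
    rw [abs_epsConj hD hsq he, inv_mul_le_one₀ hpos]
    exact negAlphaConj_le_epsReal hD hsq he
  have hle : |epsConj D ε| ≤ negAlphaConj D := by
    rw [abs_epsConj hD hsq he, inv_le_iff_one_le_mul₀ hpos, mul_comm]
    refine (one_le_alphaReal_mul_negAlphaConj hD hsq).trans ?_
    exact mul_le_mul_of_nonneg_right (alphaReal_le_epsReal hD hsq he) hb.le
  have h0 := abs_nonneg (epsConj D ε)
  rcases abs_choice (epsConj D ε) with h | h <;> rw [h] at hlt hmul hle h0 <;>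
    constructor <;> nlinarith

-- If the vertical segment through `v` leaves `R_i` before its image leaves `R_j + q`, then the
-- image of a horizontal edge of `R_i` crosses the interior of `R_j + q`.
lemma unstable_mem_Ioo_of_flow_mem {i j : Fin 2} {q v w : V} (hq : q ∈ lattice D)
    (hv : v ∈ planeR D i) (hvq : flow D ε 1 v - q ∈ planeR D j) (hw : w ∈ planeR D j) :
    (w.2 + q.2) / epsReal D ε ∈ Ioo 0 (uHi D i) := by
  have hpos := epsReal_pos he
  rw [planeR_eq] at hv hvq hw
  simp only [flow, zpow_one] at hvq
  by_contra hcon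
  have hfv : (epsReal D ε * v.2 - q.2 + q.2) / epsReal D ε ∈ Ioo 0 (uHi D i) := by
    rw [sub_add_cancel, mul_div_cancel_left₀ _ hpos.ne']
    exact hv.2
  obtain ⟨z, hz, hzp⟩ := exists_eq_endpoint (f := fun u => (u + q.2) / epsReal D ε)
    (by fun_prop) hvq.2 hw.2 hfv hcon
  obtain ⟨r, hr, hr2, hr1⟩ := exists_lattice_horizontal_edge hD hsq i
    (v := (v.1, (z + q.2) / epsReal D ε)) hv.1 hzp
  refine notMem_planeR_of_horizontal hD hsq (i := j) (v := (epsConj D ε * v.1 - q.1, z))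
    ((lattice D).sub_mem (flow_mem_lattice hD hsq he 1 hr) hq) ?_ ?_ ?_
  · simp only [flow, Prod.snd_sub, zpow_one, ← hr2]
    field_simp
    ring
  · simp only [flow, Prod.fst_sub, zpow_one, sub_sub_sub_cancel_right, ← mul_sub]
    exact epsConj_mul_mem hD hsq he hr1
  · rw [planeR_eq]
    exact ⟨hvq.1, hz⟩

-- If the horizontal segment through `φ(v)` leaves `R_j + q` inside `φ(R_i)`, then the preimage of
-- a vertical edge of `R_j + q` crosses the interior of `R_i`.
lemma stable_mem_Ioo_of_flow_mem {i j : Fin 2} {q v v' : V} (hq : q ∈ lattice D)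
    (hv : v ∈ planeR D i) (hvq : flow D ε 1 v - q ∈ planeR D j) (hv' : v' ∈ planeR D i) :
    epsConj D ε * v'.1 - q.1 ∈ Ioo (sLo j) (sHi D j) := by
  have hpos := epsReal_pos he
  have hne := epsConj_ne_zero hD hsq he
  rw [planeR_eq] at hv hvq hv'
  simp only [flow, zpow_one] at hvq
  by_contra hcon
  obtain ⟨z, hz, hzp⟩ := exists_eq_endpoint (f := fun s => epsConj D ε * s - q.1)
    (by fun_prop) hv.1 hv'.1 hvq.1 hcon
  obtain ⟨r, hr, hr1, hr0, hra⟩ := exists_lattice_vertical_edge hD hsq j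
    (v := (epsConj D ε * z - q.1, epsReal D ε * v.2 - q.2)) hzp hvq.2
  have hsub : v.2 - (flow D ε (-1) (r + q)).2 =
      (epsReal D ε)⁻¹ * (epsReal D ε * v.2 - q.2 - r.2) := by
    simp only [flow, Prod.snd_add, zpow_neg_one]
    field_simp
    ring
  refine notMem_planeR_of_vertical hD hsq (i := i) (v := (z, v.2))
    (flow_mem_lattice hD hsq he (-1) ((lattice D).add_mem hr hq)) ?_ ⟨?_, ?_⟩ ?_
  · simp only [flow, Prod.fst_add, zpow_neg_one, ← hr1]
    field_simp
    ring
  · rw [hsub]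
    positivity
  · rw [hsub]
    exact (mul_le_of_le_one_left hr0 (inv_lt_one_of_one_lt₀ he).le).trans hra
  · rw [planeR_eq]
    exact ⟨hz, hv.2⟩

lemma planeR_markov {i j : Fin 2} {q v v' w : V} (hq : q ∈ lattice D) (hv : v ∈ planeR D i)
    (hvq : flow D ε 1 v - q ∈ planeR D j) (hv' : v' ∈ planeR D i) (hw : w ∈ planeR D j) :
    (v'.1, (w.2 + q.2) / epsReal D ε) ∈ planeR D i ∧
      (epsConj D ε * v'.1 - q.1, w.2) ∈ planeR D j := by
  have hu := unstable_mem_Ioo_of_flow_mem hD hsq he hq hv hvq hw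
  have hs := stable_mem_Ioo_of_flow_mem hD hsq he hq hv hvq hv'
  rw [planeR_eq] at hv' hw ⊢
  rw [planeR_eq]
  exact ⟨⟨hv'.1, hu⟩, hs, hw.2⟩

end Markov

section Partition

variable {D : ℕ} {ε : (OK D)ˣ}

/-- `φ` maps some point of the planar set `A` into the translate by `q` of the planar set `B`. -/
def Step (D : ℕ) (ε : (OK D)ˣ) (A B : Set V) (q : V) : Prop :=
  q ∈ lattice D ∧ ∃ v ∈ A, flow D ε 1 v - q ∈ B

/-- The Markov property of the partition `P0`, together with the uniqueness of the lattice
translation in each transition, which the cut into connected components ensures. -/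
structure IsMarkov (D : ℕ) (ε : (OK D)ˣ) : Prop where
  finite : (P0 D ε).Finite
  product : ∀ A ∈ P0 D ε, ∀ v ∈ rep D A, ∀ w ∈ rep D A, (v.1, w.2) ∈ rep D A
  lift : ∀ A ∈ P0 D ε, ∀ x ∈ A, ∃ v ∈ rep D A, proj D v = x
  disjoint : ∀ A ∈ P0 D ε, ∀ B ∈ P0 D ε, ∀ x ∈ A, x ∈ B → A = B
  cover : ∀ v, Generic D v → ∃ A ∈ P0 D ε, proj D v ∈ A
  unique : ∀ A ∈ P0 D ε, ∀ B ∈ P0 D ε, ∀ q q', Step D ε (rep D A) (rep D B) q →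
    Step D ε (rep D A) (rep D B) q' → q = q'
  markov : ∀ A ∈ P0 D ε, ∀ B ∈ P0 D ε, ∀ q, Step D ε (rep D A) (rep D B) q →
    ∀ v ∈ rep D A, ∀ w ∈ rep D B, (v.1, (w.2 + q.2) / epsReal D ε) ∈ rep D A ∧
      (epsConj D ε * v.1 - q.1, w.2) ∈ rep D B

/-- The part of `R_i` that `φ` maps into the translate by `q` of `R_j`. -/
def strip (D : ℕ) (ε : (OK D)ˣ) (i j : Fin 2) (q : V) : Set V :=
  {v | v ∈ planeR D i ∧ flow D ε 1 v - q ∈ planeR D j}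

lemma planeR_product {i : Fin 2} {v w : V} (hv : v ∈ planeR D i) (hw : w ∈ planeR D i) :
    (v.1, w.2) ∈ planeR D i := by
  rw [planeR_eq] at *
  exact ⟨hv.1, hw.2⟩

lemma strip_product {i j : Fin 2} {q v w : V} (hv : v ∈ strip D ε i j q)
    (hw : w ∈ strip D ε i j q) : (v.1, w.2) ∈ strip D ε i j q :=
  ⟨planeR_product hv.1 hw.1, planeR_product hv.2 hw.2⟩

lemma isOpen_planeR (i : Fin 2) : IsOpen (planeR D i) := by
  rw [planeR_eq]
  exact isOpen_Ioo.prod isOpen_Ioo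

lemma convex_planeR (i : Fin 2) : Convex ℝ (planeR D i) := by
  rw [planeR_eq]
  exact (convex_Ioo _ _).prod (convex_Ioo _ _)

lemma continuous_flow (i : ℤ) : Continuous (flow D ε i) := by
  unfold flow
  fun_prop

lemma continuous_proj : Continuous (proj D) := continuous_quotient_mk'

lemma isOpenMap_proj : IsOpenMap (proj D) := QuotientAddGroup.isOpenMap_coe

lemma isOpen_strip (i j : Fin 2) (q : V) : IsOpen (strip D ε i j q) :=
  (isOpen_planeR i).inter
    ((isOpen_planeR j).preimage ((continuous_flow 1).sub continuous_const))

lemma convex_strip (i j : Fin 2) (q : V) : Convex ℝ (strip D ε i j q) := by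
  rintro v ⟨hv, hvq⟩ w ⟨hw, hwq⟩ a b ha hb hab
  refine ⟨convex_planeR i hv hw ha hb hab, ?_⟩
  have hflow : flow D ε 1 (a • v + b • w) - q =
      a • (flow D ε 1 v - q) + b • (flow D ε 1 w - q) := by
    obtain rfl : b = 1 - a := by linarith
    refine Prod.ext ?_ ?_ <;> simp [flow] <;> ring
  rw [hflow]
  exact convex_planeR j hvq hwq ha hb hab

lemma strip_subset_footprint (i j : Fin 2) (q : V) : strip D ε i j q ⊆ footprint D :=
  fun _ hv => planeR_subset_footprint i hv.1

lemma mem_torusR_inter_iff {i j : Fin 2} {x : Torus D} :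
    x ∈ torusR D i ∩ phi D ε ⁻¹' torusR D j ↔ ∃ q ∈ lattice D, x ∈ proj D '' strip D ε i j q := by
  constructor
  · rintro ⟨⟨v, hv, rfl⟩, w, hw, hvw⟩
    rw [phi_proj] at hvw
    refine ⟨flow D ε 1 v - w, proj_eq_iff.1 hvw.symm, v, ⟨hv, ?_⟩, rfl⟩
    rwa [sub_sub_cancel]
  · rintro ⟨q, hq, v, ⟨hv, hvq⟩, rfl⟩
    refine ⟨⟨v, hv, rfl⟩, _, hvq, ?_⟩
    rw [phi_proj, proj_eq_iff]
    simpa using hq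

variable (hD : 1 < D) (hsq : Squarefree D)
include hD hsq

lemma rep_proj_image {S : Set V} (hS : S ⊆ footprint D) : rep D (proj D '' S) = S := by
  ext v
  constructor
  · rintro ⟨hv, w, hw, hvw⟩
    obtain ⟨i, hi⟩ := mem_footprint_iff.1 hv
    obtain ⟨j, hj⟩ := mem_footprint_iff.1 (hS hw)
    rw [(eq_of_mem_planeR_of_sub_mem_lattice hD hsq hi hj (proj_eq_iff.1 hvw.symm)).1]
    exact hw
  · exact fun hv => ⟨hS hv, v, hv, rfl⟩

lemma rep_torusR (i : Fin 2) : rep D (torusR D i) = planeR D i :=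
  rep_proj_image hD hsq (planeR_subset_footprint i)

lemma rep_proj_image_strip (i j : Fin 2) (q : V) :
    rep D (proj D '' strip D ε i j q) = strip D ε i j q :=
  rep_proj_image hD hsq (strip_subset_footprint i j q)

lemma eq_of_mem_torusR {i j : Fin 2} {x : Torus D} (hi : x ∈ torusR D i) (hj : x ∈ torusR D j) :
    i = j := by
  obtain ⟨v, hv, rfl⟩ := hi
  obtain ⟨w, hw, hvw⟩ := hj
  exact (eq_of_mem_planeR_of_sub_mem_lattice hD hsq hv hw (proj_eq_iff.1 hvw.symm)).2

lemma Generic.exists_mem_torusR {v : V} (hv : Generic D v) : ∃ i, proj D v ∈ torusR D i := by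
  obtain ⟨q, hq, h⟩ := hv.exists_sub_mem hD hsq
  obtain ⟨i, hi⟩ := mem_footprint_iff.1 h
  exact ⟨i, v - q, hi, proj_eq_iff.2 (by simpa using hq)⟩

lemma unstable_mapsTo_of_step (he : 1 < epsReal D ε) {i j : Fin 2} {q : V}
    (h : Step D ε (planeR D i) (planeR D j) q) :
    MapsTo (fun u => (u + q.2) / epsReal D ε) (Icc 0 (uHi D j)) (Icc 0 (uHi D i)) := by
  obtain ⟨hq, v, hv, hvq⟩ := h
  rw [← closure_Ioo (uHi_pos hD hsq i).ne, ← closure_Ioo (uHi_pos hD hsq j).ne]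
  refine MapsTo.closure (fun u hu => ?_) (by fun_prop)
  refine unstable_mem_Ioo_of_flow_mem hD hsq he hq hv hvq (w := ((flow D ε 1 v - q).1, u)) ?_
  rw [planeR_eq] at hvq ⊢
  exact ⟨hvq.1, hu⟩

lemma stable_mapsTo_of_step (he : 1 < epsReal D ε) {i j : Fin 2} {q : V}
    (h : Step D ε (planeR D i) (planeR D j) q) :
    MapsTo (fun s => epsConj D ε * s - q.1) (Icc (sLo i) (sHi D i)) (Icc (sLo j) (sHi D j)) := by
  obtain ⟨hq, v, hv, hvq⟩ := h
  rw [← closure_Ioo (sLo_lt_sHi hD hsq i).ne, ← closure_Ioo (sLo_lt_sHi hD hsq j).ne]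
  refine MapsTo.closure (fun s hs => ?_) (by fun_prop)
  refine stable_mem_Ioo_of_flow_mem hD hsq he hq hv hvq (v' := (s, v.2)) ?_
  rw [planeR_eq] at hv ⊢
  exact ⟨hs, hv.2⟩

lemma abs_sub_snd_le_of_step (he : 1 < epsReal D ε) {i j : Fin 2} {q q' : V}
    (h : Step D ε (planeR D i) (planeR D j) q) (h' : Step D ε (planeR D i) (planeR D j) q') :
    |(q - q').2| ≤ epsReal D ε * uHi D i - uHi D j := by
  have hpos := epsReal_pos he
  have bounds : ∀ q, Step D ε (planeR D i) (planeR D j) q →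
      0 ≤ q.2 ∧ q.2 + uHi D j ≤ epsReal D ε * uHi D i := fun q h => by
    have hmaps := unstable_mapsTo_of_step hD hsq he h
    have hlo := (hmaps (left_mem_Icc.2 (uHi_pos hD hsq j).le)).1
    have hhi := (hmaps (right_mem_Icc.2 (uHi_pos hD hsq j).le)).2
    simp only [zero_add] at hlo hhi
    rw [div_le_iff₀ hpos] at hhi
    rw [le_div_iff₀ hpos, zero_mul] at hlo
    exact ⟨hlo, by linarith⟩
  obtain ⟨hlo, hhi⟩ := bounds q h
  obtain ⟨hlo', hhi'⟩ := bounds q' h'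
  rw [abs_le, Prod.snd_sub]
  constructor <;> linarith

lemma abs_sub_fst_le_of_step (he : 1 < epsReal D ε) {i j : Fin 2} {q q' : V}
    (h : Step D ε (planeR D i) (planeR D j) q) (h' : Step D ε (planeR D i) (planeR D j) q') :
    |(q - q').1| ≤ sHi D j - sLo j - (epsReal D ε)⁻¹ * (sHi D i - sLo i) := by
  have hle := (sLo_lt_sHi hD hsq i).le
  have bounds : ∀ q, Step D ε (planeR D i) (planeR D j) q →
      epsConj D ε * sLo i - q.1 ∈ Icc (sLo j) (sHi D j) ∧
        epsConj D ε * sHi D i - q.1 ∈ Icc (sLo j) (sHi D j) := fun q h =>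
    ⟨stable_mapsTo_of_step hD hsq he h (left_mem_Icc.2 hle),
      stable_mapsTo_of_step hD hsq he h (right_mem_Icc.2 hle)⟩
  obtain ⟨⟨hl1, hl2⟩, hr1, hr2⟩ := bounds q h
  obtain ⟨⟨hl1', hl2'⟩, hr1', hr2'⟩ := bounds q' h'
  rw [abs_le, Prod.fst_sub, ← abs_epsConj hD hsq he]
  rcases abs_choice (epsConj D ε) with h | h <;> rw [h] <;> constructor <;> linarith

omit hD hsq in
-- Two translations differ by a lattice vector which is too short to be nonzero.
lemma planeR_step_unique_of_eq_five {ε : (OK 5)ˣ} (hε : IsFundamentalUnit 5 ε) {i j : Fin 2}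
    {q q' : V} (h : Step 5 ε (planeR 5 i) (planeR 5 j) q)
    (h' : Step 5 ε (planeR 5 i) (planeR 5 j) q') : q = q' := by
  have hD : 1 < 5 := by norm_num
  have hsq : Squarefree 5 := Nat.prime_five.squarefree
  have heq := epsReal_eq_alphaReal_of_eq_five hε
  obtain ⟨hmul, hsub⟩ := golden_ratio_of_eq_five
  have hb := negAlphaConj_pos hD hsq
  have hα : alphaReal 5 = negAlphaConj 5 + 1 := by linarith
  have hb1 : negAlphaConj 5 < 1 := by nlinarith
  have hfst := abs_sub_fst_le_of_step hD hsq hε.1 h h'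
  have hsnd := abs_sub_snd_le_of_step hD hsq hε.1 h h'
  rw [heq] at hsnd
  rw [heq, inv_eq_of_mul_eq_one_right hmul] at hfst
  refine sub_eq_zero.1 (eq_zero_of_absNorm_lt_one hD hsq ((lattice 5).sub_mem h.1 h'.1) ?_)
  rw [absNorm, abs_mul]
  refine (mul_le_mul hfst hsnd (abs_nonneg _) ((abs_nonneg _).trans hfst)).trans_lt ?_
  rw [hα] at hmul ⊢
  fin_cases i <;> fin_cases j <;> simp only [sHi, sLo, uHi, Fin.zero_eta, Fin.mk_one,
    Matrix.cons_val_zero, Matrix.cons_val_one] <;> try rw [hα]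
  all_goals nlinarith

omit hD hsq in
lemma isMarkov_of_eq_five {ε : (OK 5)ˣ} (hε : IsFundamentalUnit 5 ε) : IsMarkov 5 ε := by
  have hD : 1 < 5 := by norm_num
  have hsq : Squarefree 5 := Nat.prime_five.squarefree
  have hP : P0 5 ε = range (torusR 5) := if_pos rfl
  have hrep := rep_torusR hD hsq
  constructor <;> rw [hP] <;> try (rw [forall_mem_range]; intro i)
  · exact finite_range _
  · rw [hrep]
    exact fun v hv w hw => planeR_product hv hw
  · rw [hrep]
    exact fun x hx => hx
  · rintro _ ⟨j, rfl⟩ x hx hx'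
    rw [eq_of_mem_torusR hD hsq hx hx']
  · intro v hv
    obtain ⟨i, hi⟩ := hv.exists_mem_torusR hD hsq
    exact ⟨_, ⟨i, rfl⟩, hi⟩
  · rintro _ ⟨j, rfl⟩ q q' h h'
    rw [hrep, hrep] at h h'
    exact planeR_step_unique_of_eq_five hε h h'
  · rintro _ ⟨j, rfl⟩ q h v hv w hw
    rw [hrep] at *
    rw [hrep] at *
    obtain ⟨hq, x, hx, hxq⟩ := h
    exact planeR_markov hD hsq hε.1 hq hx hxq hv hw

lemma strip_unique {i j i' j' : Fin 2} {q q' : V}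
    (hq : q ∈ lattice D) (hq' : q' ∈ lattice D) {x : Torus D}
    (h : x ∈ proj D '' strip D ε i j q) (h' : x ∈ proj D '' strip D ε i' j' q') :
    i = i' ∧ j = j' ∧ q = q' := by
  obtain ⟨v, ⟨hv, hvq⟩, rfl⟩ := h
  obtain ⟨w, ⟨hw, hwq⟩, hvw⟩ := h'
  obtain ⟨rfl, rfl⟩ := eq_of_mem_planeR_of_sub_mem_lattice hD hsq hv hw (proj_eq_iff.1 hvw.symm)
  obtain ⟨heq, rfl⟩ := eq_of_mem_planeR_of_sub_mem_lattice hD hsq hvq hwq (by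
    rw [sub_sub_sub_cancel_left]
    exact (lattice D).sub_mem hq' hq)
  exact ⟨rfl, rfl, sub_right_injective heq⟩

-- The images of the strips with different `q` are disjoint, open and connected.
lemma connectedComponentIn_torusR {i j : Fin 2} {q : V} (hq : q ∈ lattice D) {x : Torus D}
    (hx : x ∈ proj D '' strip D ε i j q) :
    connectedComponentIn (torusR D i ∩ phi D ε ⁻¹' torusR D j) x =
      proj D '' strip D ε i j q := by
  have hxS := mem_torusR_inter_iff.2 ⟨q, hq, hx⟩
  apply Subset.antisymm
  · let W : Set (Torus D) := ⋃ q' ∈ {q' | q' ∈ lattice D ∧ q' ≠ q}, proj D '' strip D ε i j q'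
    refine isPreconnected_connectedComponentIn.subset_left_of_subset_union (v := W)
      (isOpenMap_proj _ (isOpen_strip i j q))
      (isOpen_biUnion fun q' _ => isOpenMap_proj _ (isOpen_strip i j q')) ?_ ?_ ?_
    · rw [Set.disjoint_left]
      intro y hy hyW
      obtain ⟨q', ⟨hq', hne⟩, hy'⟩ := mem_iUnion₂.1 hyW
      exact hne (strip_unique hD hsq hq hq' hy hy').2.2.symm
    · intro y hy
      obtain ⟨q', hq', hy'⟩ := mem_torusR_inter_iff.1 (connectedComponentIn_subset _ _ hy)
      by_cases h : q' = q
      · exact Or.inl (h ▸ hy')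
      · exact Or.inr (mem_iUnion₂.2 ⟨q', ⟨hq', h⟩, hy'⟩)
    · exact ⟨x, mem_connectedComponentIn hxS, hx⟩
  · exact ((convex_strip i j q).isPreconnected.image _ continuous_proj.continuousOn)
      |>.subset_connectedComponentIn hx fun y hy => mem_torusR_inter_iff.2 ⟨q, hq, hy⟩

lemma mem_P0_iff_of_ne_five (h5 : D ≠ 5) {A : Set (Torus D)} :
    A ∈ P0 D ε ↔ ∃ i j, ∃ q ∈ lattice D, (strip D ε i j q).Nonempty ∧
      A = proj D '' strip D ε i j q := by
  rw [P0, if_neg h5]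
  constructor
  · rintro ⟨i, j, x, hx, rfl⟩
    obtain ⟨q, hq, hxq⟩ := mem_torusR_inter_iff.1 hx
    exact ⟨i, j, q, hq, hxq.imp fun v hv => hv.1, connectedComponentIn_torusR hD hsq hq hxq⟩
  · rintro ⟨i, j, q, hq, ⟨v, hv⟩, rfl⟩
    have hx : proj D v ∈ proj D '' strip D ε i j q := ⟨v, hv, rfl⟩
    exact ⟨i, j, proj D v, mem_torusR_inter_iff.2 ⟨q, hq, hx⟩,
      (connectedComponentIn_torusR hD hsq hq hx).symm⟩

lemma norm_flow_le (he : 1 < epsReal D ε) (v : V) : ‖flow D ε 1 v‖ ≤ epsReal D ε * ‖v‖ := by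
  have hpos := epsReal_pos he
  have hlt := abs_epsConj_lt_one hD hsq he
  rw [flow, zpow_one, zpow_one, Prod.norm_mk, max_le_iff, norm_mul, norm_mul, Real.norm_eq_abs,
    Real.norm_eq_abs (epsReal D ε), abs_of_pos hpos]
  constructor
  · exact mul_le_mul (hlt.trans he).le (norm_fst_le v) (norm_nonneg _) hpos.le
  · exact mul_le_mul_of_nonneg_left (norm_snd_le v) hpos.le

lemma norm_le_of_strip_nonempty (he : 1 < epsReal D ε) {i j : Fin 2} {q : V}
    (h : (strip D ε i j q).Nonempty) :
    ‖q‖ ≤ (epsReal D ε + 1) * (1 + alphaReal D + negAlphaConj D) := by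
  obtain ⟨v, hv, hvq⟩ := h
  have hbound : ∀ {k : Fin 2} {w : V}, w ∈ planeR D k →
      ‖w‖ ≤ 1 + alphaReal D + negAlphaConj D := fun {k} {w} hw =>
    norm_le_of_mem_closedFootprint hD hsq
      (footprint_subset_closedFootprint (planeR_subset_footprint k hw))
  calc ‖q‖ = ‖flow D ε 1 v - (flow D ε 1 v - q)‖ := by rw [sub_sub_cancel]
    _ ≤ epsReal D ε * ‖v‖ + ‖flow D ε 1 v - q‖ :=
      (norm_sub_le _ _).trans (add_le_add_left (norm_flow_le hD hsq he v) _)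
    _ ≤ epsReal D ε * (1 + alphaReal D + negAlphaConj D) + (1 + alphaReal D + negAlphaConj D) :=
      add_le_add (mul_le_mul_of_nonneg_left (hbound hv) (epsReal_pos he).le) (hbound hvq)
    _ = _ := by ring

lemma finite_P0_of_ne_five (h5 : D ≠ 5) (he : 1 < epsReal D ε) : (P0 D ε).Finite := by
  let R := (epsReal D ε + 1) * (1 + alphaReal D + negAlphaConj D)
  refine ((finite_univ (α := Fin 2 × Fin 2)).prod (finite_lattice_inter_closedBall hD hsq R)).image
    (fun p => proj D '' strip D ε p.1.1 p.1.2 p.2) |>.subset fun A hA => ?_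
  obtain ⟨i, j, q, hq, hne, rfl⟩ := (mem_P0_iff_of_ne_five hD hsq h5).1 hA
  exact ⟨((i, j), q), ⟨trivial, hq, mem_closedBall_zero_iff.2
    (norm_le_of_strip_nonempty hD hsq he hne)⟩, rfl⟩

lemma eq_of_step_strip {i j i' j' : Fin 2} {q q' r : V} (hq : q ∈ lattice D)
    (h : Step D ε (strip D ε i j q) (strip D ε i' j' q') r) : r = q ∧ i' = j := by
  obtain ⟨hr, v, ⟨-, hv⟩, hv', -⟩ := h
  obtain ⟨heq, rfl⟩ := eq_of_mem_planeR_of_sub_mem_lattice hD hsq hv' hv (by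
    rw [sub_sub_sub_cancel_left]
    exact (lattice D).sub_mem hq hr)
  exact ⟨sub_right_injective heq, rfl⟩

lemma strip_markov (he : 1 < epsReal D ε) {i j k : Fin 2} {q q' v w : V} (hq : q ∈ lattice D)
    (hq' : q' ∈ lattice D) (hv : v ∈ strip D ε i j q) (hw : w ∈ strip D ε j k q') :
    (v.1, (w.2 + q.2) / epsReal D ε) ∈ strip D ε i j q ∧
      (epsConj D ε * v.1 - q.1, w.2) ∈ strip D ε j k q' := by
  obtain ⟨hvw, hwv⟩ := planeR_markov hD hsq he hq hv.1 hv.2 hv.1 hw.1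
  have hwv' := (planeR_markov hD hsq he hq' hw.1 hw.2 hwv hw.2).2
  refine ⟨⟨hvw, ?_⟩, hwv, ?_⟩
  · have hne := (epsReal_pos he).ne'
    convert hwv using 1
    refine Prod.ext (by simp [flow]) ?_
    simp only [flow, zpow_one, Prod.snd_sub]
    field_simp
    ring
  · convert hwv' using 1
    refine Prod.ext ?_ ?_ <;> simp [flow]

lemma isMarkov_of_ne_five (h5 : D ≠ 5) (he : 1 < epsReal D ε) : IsMarkov D ε := by
  have hP : ∀ A, A ∈ P0 D ε → _ := fun A => (mem_P0_iff_of_ne_five hD hsq h5).1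
  have hrep := rep_proj_image_strip (ε := ε) hD hsq
  refine ⟨finite_P0_of_ne_five hD hsq h5 he, ?_, ?_, ?_, ?_, ?_, ?_⟩ <;> intro A hA <;>
    try obtain ⟨i, j, q, hq, -, rfl⟩ := hP A hA
  · rw [hrep]
    exact fun v hv w hw => strip_product hv hw
  · rw [hrep]
    exact fun x hx => hx
  · intro B hB x hxA hxB
    obtain ⟨i', j', q', hq', -, rfl⟩ := hP B hB
    obtain ⟨rfl, rfl, rfl⟩ := strip_unique hD hsq hq hq' hxA hxB
    rfl
  · obtain ⟨i, hi⟩ := hA.exists_mem_torusR hD hsq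
    obtain ⟨j, hj⟩ := (hA.flow hD hsq he 1).exists_mem_torusR hD hsq
    rw [← phi_proj] at hj
    obtain ⟨q, hq, hx⟩ := mem_torusR_inter_iff.1 ⟨hi, hj⟩
    exact ⟨_, (mem_P0_iff_of_ne_five hD hsq h5).2
      ⟨i, j, q, hq, hx.imp fun v hv => hv.1, rfl⟩, hx⟩
  · intro B hB r r' h h'
    obtain ⟨i', j', q', -, -, rfl⟩ := hP B hB
    rw [hrep, hrep] at h h'
    rw [(eq_of_step_strip hD hsq hq h).1, (eq_of_step_strip hD hsq hq h').1]
  · intro B hB r h v hv w hw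
    obtain ⟨i', j', q', hq', -, rfl⟩ := hP B hB
    rw [hrep] at *
    rw [hrep] at *
    obtain ⟨rfl, rfl⟩ := eq_of_step_strip hD hsq hq h
    exact strip_markov hD hsq he hq hq' hv hw

lemma isMarkov (he : 1 < epsReal D ε) (hfund : D = 5 → IsFundamentalUnit D ε) :
    IsMarkov D ε := by
  by_cases h5 : D = 5
  · subst h5
    exact isMarkov_of_eq_five (hfund rfl)
  · exact isMarkov_of_ne_five hD hsq h5 he

end Partition

/-! ### The coding map -/

section Coding

variable {D : ℕ} {ε : (OK D)ˣ}

open Classical in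
/-- The lattice vector `q` such that `φ` maps `A` across the translate by `q` of `B`; the junk
value `0` when there is none. -/
def stepVector (A B : P0 D ε) : V :=
  if h : ∃ q, Step D ε (rep D A) (rep D B) q then h.choose else 0

/-- The point of the plane coded by a string: it solves `φ(code s) - code (shift s) =
stepVector (s 0) (s 1)`, summed over the past in the contracting coordinate and over the future in
the expanding one. -/
def code (s : ℤ → P0 D ε) : V :=
  (-∑' k : ℕ, (stepVector (s (-k - 1)) (s (-k))).1 * epsConj D ε ^ k,
    ∑' k : ℕ, (stepVector (s k) (s (k + 1))).2 * (epsReal D ε)⁻¹ ^ (k + 1))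

/-- The point coded by the `k`-th shift of a string. -/
def codeAt (s : ℤ → P0 D ε) (k : ℤ) : V := code fun i => s (i + k)

/-- The word `s_{-n} ⋯ s_n`. -/
def centralWord (s : ℤ → P0 D ε) (n : ℕ) : Word D ε n := fun i => s i

lemma codeAt_zero (s : ℤ → P0 D ε) : codeAt s 0 = code s := by simp only [codeAt, add_zero]

lemma mem_rect_iff {n : ℕ} {w : Word D ε n} {x : Torus D} :
    x ∈ rect D ε n w ↔ ∀ i : Icc (-(n : ℤ)) n, (phi D ε ^ (i : ℤ)) x ∈ (w i : Set (Torus D)) := by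
  simp only [rect, mem_iInter, mem_preimage]

lemma stepVector_mem_lattice (A B : P0 D ε) : stepVector A B ∈ lattice D := by
  unfold stepVector
  split_ifs with h
  · exact h.choose_spec.1
  · exact (lattice D).zero_mem

lemma norm_mul_pow_le {a x C : ℝ} (h : ‖a‖ ≤ C) (k : ℕ) : ‖a * x ^ k‖ ≤ C * ‖x‖ ^ k := by
  rw [norm_mul, norm_pow]
  exact mul_le_mul_of_nonneg_right h (by positivity)

lemma summable_const_mul_norm_pow (C : ℝ) {x : ℝ} (hx : ‖x‖ < 1) :
    Summable fun k : ℕ => C * ‖x‖ ^ k :=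
  (summable_geometric_of_lt_one (norm_nonneg x) hx).mul_left C

lemma norm_inv_epsReal_lt_one (he : 1 < epsReal D ε) : ‖(epsReal D ε)⁻¹‖ < 1 := by
  rw [Real.norm_of_nonneg (inv_nonneg.2 (epsReal_pos he).le)]
  exact inv_lt_one_of_one_lt₀ he

lemma tendsto_const_mul_inv_epsReal_pow (he : 1 < epsReal D ε) (C : ℝ) :
    Tendsto (fun n : ℕ => C * (epsReal D ε)⁻¹ ^ n) atTop (𝓝 0) := by
  simpa using
    (tendsto_pow_atTop_nhds_zero_of_norm_lt_one (norm_inv_epsReal_lt_one he)).const_mul C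

lemma rep_subset_closedFootprint (A : Set (Torus D)) : rep D A ⊆ closedFootprint D :=
  inter_subset_left.trans footprint_subset_closedFootprint

lemma continuous_pair_of_discrete {A X : Type*} [TopologicalSpace A] [DiscreteTopology A]
    [TopologicalSpace X] (f : A → A → X) (i j : ℤ) : Continuous fun s : ℤ → A => f (s i) (s j) :=
  (continuous_of_discreteTopology (f := fun p : A × A => f p.1 p.2)).comp
    (by fun_prop : Continuous fun s : ℤ → A => (s i, s j))

section IsMarkov

variable (hM : IsMarkov D ε)
include hM

lemma IsMarkov.step_stepVector {A B : P0 D ε}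
    (h : ((A : Set (Torus D)) ∩ phi D ε ⁻¹' (B : Set (Torus D))).Nonempty) :
    Step D ε (rep D A) (rep D B) (stepVector A B) := by
  obtain ⟨x, hxA, hxB⟩ := h
  obtain ⟨v, hv, rfl⟩ := hM.lift A A.2 x hxA
  obtain ⟨w, hw, hwv⟩ := hM.lift B B.2 _ hxB
  rw [phi_proj] at hwv
  have hex : ∃ q, Step D ε (rep D A) (rep D B) q :=
    ⟨flow D ε 1 v - w, proj_eq_iff.1 hwv.symm, v, hv, by rwa [sub_sub_cancel]⟩
  rw [stepVector, dif_pos hex]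
  exact hex.choose_spec

lemma IsMarkov.exists_norm_stepVector_le : ∃ C, ∀ A B : P0 D ε, ‖stepVector A B‖ ≤ C := by
  have := hM.finite.to_subtype
  obtain ⟨C, hC⟩ := (finite_range fun p : P0 D ε × P0 D ε => ‖stepVector p.1 p.2‖).bddAbove
  exact ⟨C, fun A B => hC ⟨(A, B), rfl⟩⟩

-- The Markov property lets an orbit be prescribed by its stable coordinate at the start and its
-- unstable coordinate at the end.
lemma IsMarkov.mem_rep_of_endpoints (he : 1 < epsReal D ε) {s : ℤ → P0 D ε} (hs : s ∈ Sig D ε)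
    {y : ℤ → V} (hy : ∀ k, y (k + 1) = flow D ε 1 (y k) - stepVector (s k) (s (k + 1))) {m n : ℤ}
    (hmn : m ≤ n) (hm : (y m).1 ∈ Prod.fst '' rep D (s m))
    (hn : (y n).2 ∈ Prod.snd '' rep D (s n)) : ∀ i ∈ Icc m n, y i ∈ rep D (s i) := by
  induction n, hmn using Int.leInduction with
  | base =>
    intro i hi
    obtain rfl : i = m := le_antisymm hi.2 hi.1
    obtain ⟨v, hv, hv1⟩ := hm
    obtain ⟨w, hw, hw2⟩ := hn
    have hvw := hM.product _ (s i).2 v hv w hw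
    rwa [hv1, hw2] at hvw
  | succ n hmn ih =>
    have hstep := hM.step_stepVector (hs n)
    have hmarkov := hM.markov _ (s n).2 _ (s (n + 1)).2 _ hstep
    obtain ⟨u, hu, -⟩ := hstep.2
    obtain ⟨w, hw, hw2⟩ := hn
    have hsnd : (w.2 + (stepVector (s n) (s (n + 1))).2) / epsReal D ε = (y n).2 := by
      rw [hw2, hy, flow, Prod.snd_sub, zpow_one, zpow_one, sub_add_cancel,
        mul_div_cancel_left₀ _ (epsReal_pos he).ne']
    have hle := ih ⟨_, (hmarkov u hu w hw).1, hsnd⟩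
    intro i hi
    rcases hi.2.lt_or_eq with h | rfl
    · exact hle i ⟨hi.1, Int.lt_add_one_iff.1 h⟩
    · have hlast := (hmarkov _ (hle n ⟨hmn, le_rfl⟩) w hw).2
      rw [hw2] at hlast
      convert hlast using 1
      refine Prod.ext ?_ rfl
      rw [hy, flow, Prod.fst_sub, zpow_one, zpow_one]

end IsMarkov

section Expansion

variable (hD : 1 < D) (hsq : Squarefree D) (he : 1 < epsReal D ε)
include hD hsq he

lemma eq_flow_of_forall_succ {z : ℤ → V} {i j : ℤ} (hij : i ≤ j)
    (hz : ∀ k, i ≤ k → k < j → z (k + 1) = flow D ε 1 (z k)) : z j = flow D ε (j - i) (z i) := by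
  induction j, hij using Int.leInduction with
  | base => rw [sub_self, flow_zero]
  | succ j hij ih =>
    rw [hz j hij (lt_add_one j), ih fun k hk hkj => hz k hk (hkj.trans (lt_add_one j)),
      flow_flow hD hsq he]
    congr 1
    ring

lemma norm_le_of_abs_flow_le {v : V} {C : ℝ} {n : ℕ} (hs : |(flow D ε (-n) v).1| ≤ C)
    (hu : |(flow D ε n v).2| ≤ C) : ‖v‖ ≤ C * (epsReal D ε)⁻¹ ^ n := by
  have hpos := epsReal_pos he
  rw [flow, abs_mul, zpow_neg, zpow_natCast, abs_inv, abs_pow, abs_epsConj hD hsq he] at hs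
  rw [flow, abs_mul, zpow_natCast, abs_pow, abs_of_pos hpos] at hu
  rw [Prod.norm_def, max_le_iff, Real.norm_eq_abs, Real.norm_eq_abs]
  constructor
  · rwa [inv_mul_le_iff₀' (by positivity)] at hs
  · rwa [inv_pow, ← div_eq_mul_inv, le_div_iff₀' (by positivity)]

end Expansion

variable (hD : 1 < D) (hsq : Squarefree D) (he : 1 < epsReal D ε) (hM : IsMarkov D ε)
include hD hsq he hM

lemma code_shift (s : ℤ → P0 D ε) :
    code (shift s) = flow D ε 1 (code s) - stepVector (s 0) (s 1) := by
  obtain ⟨C, hC⟩ := hM.exists_norm_stepVector_le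
  have hpos := epsReal_pos he
  have hfst : Summable fun k : ℕ =>
      (stepVector (s (-k - 1 + 1)) (s (-k + 1))).1 * epsConj D ε ^ k :=
    .of_norm_bounded (summable_const_mul_norm_pow C (abs_epsConj_lt_one hD hsq he)) fun k =>
      norm_mul_pow_le ((norm_fst_le _).trans (hC _ _)) k
  have hsnd : Summable fun k : ℕ =>
      (stepVector (s k) (s (k + 1))).2 * (epsReal D ε)⁻¹ ^ (k + 1) :=
    .of_norm_bounded ((summable_nat_add_iff 1).2
      (summable_const_mul_norm_pow C (norm_inv_epsReal_lt_one he))) fun k =>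
      norm_mul_pow_le ((norm_snd_le _).trans (hC _ _)) (k + 1)
  refine Prod.ext ?_ ?_
  · simp only [code, flow, Prod.fst_sub, zpow_one, shift]
    rw [hfst.tsum_eq_zero_add, mul_neg, ← tsum_mul_left, neg_add, sub_eq_add_neg, add_comm]
    congr 2
    · refine tsum_congr fun k => ?_
      rw [pow_succ, show (-((k + 1 : ℕ) : ℤ) - 1 + 1) = -k - 1 by push_cast; ring,
        show (-((k + 1 : ℕ) : ℤ) + 1) = -k by push_cast; ring]
      ring
    · simp
  · simp only [code, flow, Prod.snd_sub, zpow_one, shift]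
    rw [hsnd.tsum_eq_zero_add, mul_add, ← tsum_mul_left, Nat.cast_zero, zero_add, zero_add,
      pow_one, mul_comm (stepVector _ _).2, mul_inv_cancel_left₀ hpos.ne', add_sub_cancel_left]
    refine tsum_congr fun k => ?_
    rw [pow_succ _ (k + 1)]
    push_cast
    field_simp

lemma codeAt_succ (s : ℤ → P0 D ε) (k : ℤ) :
    codeAt s (k + 1) = flow D ε 1 (codeAt s k) - stepVector (s k) (s (k + 1)) := by
  have h := code_shift hD hsq he hM fun i => s (i + k)
  have hshift : (shift fun i => s (i + k)) = fun i => s (i + (k + 1)) :=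
    funext fun i => congrArg s (add_right_comm i 1 k |>.trans (add_assoc i k 1))
  rw [hshift] at h
  simp only [zero_add, add_comm 1 k] at h
  exact h

lemma proj_codeAt_succ (s : ℤ → P0 D ε) (k : ℤ) :
    proj D (codeAt s (k + 1)) = phi D ε (proj D (codeAt s k)) := by
  rw [codeAt_succ hD hsq he hM, phi_proj, proj_eq_iff, sub_sub_cancel_left]
  exact (lattice D).neg_mem (stepVector_mem_lattice _ _)

lemma semiconj_proj_code :
    Function.Semiconj (fun s : ℤ → P0 D ε => proj D (code s)) shift (phi D ε) := fun s => by
  have h := proj_codeAt_succ hD hsq he hM s 0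
  rwa [codeAt_zero] at h

lemma proj_codeAt (s : ℤ → P0 D ε) (i : ℤ) :
    proj D (codeAt s i) = (phi D ε ^ i) (proj D (code s)) := by
  have hsucc := proj_codeAt_succ hD hsq he hM s
  induction i with
  | zero => simp [codeAt_zero]
  | succ n ih => rw [hsucc, ih, add_comm, zpow_add, Equiv.Perm.mul_apply, zpow_one]
  | pred n ih =>
    have h := hsucc (-n - 1)
    rw [sub_add_cancel, ih] at h
    rw [sub_eq_add_neg, add_comm, zpow_add, Equiv.Perm.mul_apply, zpow_neg_one,
      eq_comm, Equiv.Perm.inv_eq_iff_eq, add_comm, ← sub_eq_add_neg]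
    exact h

lemma flow_codeAt_sub_mem_lattice (s : ℤ → P0 D ε) (k i : ℤ) :
    flow D ε i (codeAt s k) - codeAt s (k + i) ∈ lattice D := by
  rw [← proj_eq_iff, ← phi_zpow_proj hD hsq he, proj_codeAt hD hsq he hM, proj_codeAt hD hsq he hM,
    add_comm, zpow_add, Equiv.Perm.mul_apply]

lemma proj_codeAt_add_flow (s : ℤ → P0 D ε) (i : ℤ) (η : V) :
    proj D (codeAt s i + flow D ε i η) = (phi D ε ^ i) (proj D (code s + η)) := by
  rw [phi_zpow_proj hD hsq he, flow_add, eq_comm, proj_eq_iff, add_sub_add_right_eq_sub,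
    ← codeAt_zero s]
  simpa only [zero_add] using flow_codeAt_sub_mem_lattice hD hsq he hM s 0 i

lemma codeAt_add_flow_mem_rep {s : ℤ → P0 D ε} (hs : s ∈ Sig D ε) {η : V} {m n : ℤ} (hmn : m ≤ n)
    (hm : (codeAt s m + flow D ε m η).1 ∈ Prod.fst '' rep D (s m))
    (hn : (codeAt s n + flow D ε n η).2 ∈ Prod.snd '' rep D (s n)) :
    ∀ i ∈ Icc m n, codeAt s i + flow D ε i η ∈ rep D (s i) := by
  refine hM.mem_rep_of_endpoints he hs (fun k => ?_) hmn hm hn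
  rw [codeAt_succ hD hsq he hM, flow_add, flow_flow hD hsq he, add_comm 1 k]
  abel

lemma continuous_code [TopologicalSpace (P0 D ε)] [DiscreteTopology (P0 D ε)] :
    Continuous (code : (ℤ → P0 D ε) → V) := by
  obtain ⟨C, hC⟩ := hM.exists_norm_stepVector_le
  refine Continuous.prodMk (Continuous.neg ?_) ?_
  · exact continuous_tsum
      (fun k => (continuous_pair_of_discrete (fun A B => (stepVector A B).1) _ _).mul_const _)
      (summable_const_mul_norm_pow C (abs_epsConj_lt_one hD hsq he))
      fun k s => norm_mul_pow_le ((norm_fst_le _).trans (hC _ _)) k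
  · exact continuous_tsum
      (fun k => (continuous_pair_of_discrete (fun A B => (stepVector A B).2) _ _).mul_const _)
      ((summable_nat_add_iff 1).2 (summable_const_mul_norm_pow C (norm_inv_epsReal_lt_one he)))
      fun k s => norm_mul_pow_le ((norm_snd_le _).trans (hC _ _)) (k + 1)

lemma exists_norm_code_sub_lt {δ : ℝ} (hδ : 0 < δ) :
    ∃ j : ℕ, ∀ s s' : ℤ → P0 D ε, EqOn s s' (Icc (-(j : ℤ)) j) → ‖code s - code s'‖ < δ := by
  have := hM.finite.to_subtype
  let : UniformSpace (P0 D ε) := ⊥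
  have : DiscreteTopology (P0 D ε) := ⟨rfl⟩
  have hu := CompactSpace.uniformContinuous_of_continuous (continuous_code hD hsq he hM)
  obtain ⟨j, -, hj⟩ := ((hasBasis_uniformity_agreeRel (P0 D ε)).uniformContinuous_iff
    Metric.uniformity_basis_dist).1 hu δ hδ
  refine ⟨j, fun s s' h => ?_⟩
  rw [← dist_eq_norm]
  exact hj s s' h

lemma exists_norm_code_le : ∃ C, ∀ s : ℤ → P0 D ε, ‖code s‖ ≤ C := by
  have := hM.finite.to_subtype
  let : TopologicalSpace (P0 D ε) := ⊥
  have : DiscreteTopology (P0 D ε) := ⟨rfl⟩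
  obtain ⟨C, hC⟩ := (isCompact_range (continuous_code hD hsq he hM)).isBounded.exists_norm_le
  exact ⟨C, fun s => hC _ ⟨s, rfl⟩⟩

lemma exists_norm_sub_codeAt_le : ∃ C, ∀ (s : ℤ → P0 D ε) (k : ℤ) (A : Set (Torus D)),
    ∀ v ∈ rep D A, ‖v - codeAt s k‖ ≤ C := by
  obtain ⟨C, hC⟩ := exists_norm_code_le hD hsq he hM
  exact ⟨1 + alphaReal D + negAlphaConj D + C, fun s k A v hv => (norm_sub_le _ _).trans
    (add_le_add (norm_le_of_mem_closedFootprint hD hsq (rep_subset_closedFootprint A hv)) (hC _))⟩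

lemma isCompact_code_image_Sig : IsCompact (code '' Sig D ε) := by
  have := hM.finite.to_subtype
  let : TopologicalSpace (P0 D ε) := ⊥
  have : DiscreteTopology (P0 D ε) := ⟨rfl⟩
  refine IsCompact.image (IsClosed.isCompact ?_) (continuous_code hD hsq he hM)
  rw [Sig, ofPred_forall]
  exact isClosed_iInter fun k => (isClosed_discrete {p : P0 D ε × P0 D ε |
    ((p.1 : Set (Torus D)) ∩ phi D ε ⁻¹' (p.2 : Set (Torus D))).Nonempty}).preimage <|
      continuous_pair_of_discrete Prod.mk k (k + 1)

lemma exists_shadow : ∃ C, ∀ s ∈ Sig D ε, ∀ N : ℕ, ∃ η : V, ‖η‖ ≤ C * (epsReal D ε)⁻¹ ^ N ∧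
    ∀ i ∈ Icc (-(N : ℤ)) N, codeAt s i + flow D ε i η ∈ rep D (s i) := by
  obtain ⟨C, hC⟩ := exists_norm_sub_codeAt_le hD hsq he hM
  refine ⟨C, fun s hs N => ?_⟩
  obtain ⟨v, hv, -⟩ := (hM.step_stepVector (hs (-N))).2
  obtain ⟨w, hw, -⟩ := (hM.step_stepVector (hs N)).2
  let η : V := ((flow D ε N (v - codeAt s (-N))).1, (flow D ε (-N) (w - codeAt s N)).2)
  have hfst : (flow D ε (-N) η).1 = (v - codeAt s (-N)).1 := by
    rw [← flow_zero (ε := ε) (v - _), ← neg_add_cancel (N : ℤ), ← flow_flow hD hsq he]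
    rfl
  have hsnd : (flow D ε N η).2 = (w - codeAt s N).2 := by
    rw [← flow_zero (ε := ε) (w - _), ← add_neg_cancel (N : ℤ), ← flow_flow hD hsq he]
    rfl
  refine ⟨η, norm_le_of_abs_flow_le hD hsq he ?_ ?_, ?_⟩
  · rw [hfst]
    exact (norm_fst_le _).trans (hC s _ _ v hv)
  · rw [hsnd]
    exact (norm_snd_le _).trans (hC s _ _ w hw)
  refine codeAt_add_flow_mem_rep hD hsq he hM hs (by omega) ⟨v, hv, ?_⟩ ⟨w, hw, ?_⟩
  · rw [Prod.fst_add, hfst, Prod.fst_sub, add_sub_cancel]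
  · rw [Prod.snd_add, hsnd, Prod.snd_sub, add_sub_cancel]

lemma code_mem_closure_rep_rect {s : ℤ → P0 D ε} (hs : s ∈ Sig D ε) (n : ℕ) :
    code s ∈ closure (rep D (rect D ε n (centralWord s n))) := by
  obtain ⟨C, hC⟩ := exists_shadow hD hsq he hM
  choose η hη hηrep using hC s hs
  have hlim : Tendsto (fun N => code s + η N) atTop (𝓝 (code s)) := by
    simpa using
      (squeeze_zero_norm hη (tendsto_const_mul_inv_epsReal_pow he C)).const_add (code s)
  refine mem_closure_of_tendsto hlim ?_
  filter_upwards [eventually_ge_atTop n] with N hN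
  have hzero := hηrep N 0 ⟨by omega, by omega⟩
  rw [flow_zero, codeAt_zero] at hzero
  refine ⟨hzero.1, mem_rect_iff.2 fun i => ?_⟩
  have hi := mem_Icc.1 i.2
  rw [← proj_codeAt_add_flow hD hsq he hM]
  exact (hηrep N i ⟨by omega, by omega⟩).2

lemma rect_centralWord_mem_P {s : ℤ → P0 D ε} (hs : s ∈ Sig D ε) (n : ℕ) :
    rect D ε n (centralWord s n) ∈ P D ε n := by
  obtain ⟨v, hv⟩ := closure_nonempty_iff.1 ⟨_, code_mem_closure_rep_rect hD hsq he hM hs n⟩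
  exact ⟨⟨_, hv.2⟩, _, rfl⟩

-- Uniqueness of the lattice translations makes the orbit of `x` follow that of `code s`, so that
-- their difference is bounded `n` steps into the past and into the future.
lemma exists_norm_sub_code_le : ∃ C, ∀ s ∈ Sig D ε, ∀ n : ℕ,
    ∀ x ∈ rep D (rect D ε n (centralWord s n)), ‖x - code s‖ ≤ C * (epsReal D ε)⁻¹ ^ n := by
  obtain ⟨C, hC⟩ := exists_norm_sub_codeAt_le hD hsq he hM
  refine ⟨C, fun s hs n x hx => ?_⟩
  have hlift : ∀ i : ℤ, -(n : ℤ) ≤ i → i ≤ n → ∃ v ∈ rep D (s i), proj D v =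
      (phi D ε ^ i) (proj D x) := fun i hi hi' =>
    hM.lift _ (s i).2 _ (mem_rect_iff.1 hx.2 ⟨i, hi, hi'⟩)
  choose! y hyrep hyproj using hlift
  have hy0 : y 0 = x := by
    obtain ⟨i, hi⟩ := mem_footprint_iff.1 (hyrep 0 (by omega) (by omega)).1
    obtain ⟨j, hj⟩ := mem_footprint_iff.1 hx.1
    refine (eq_of_mem_planeR_of_sub_mem_lattice hD hsq hi hj (proj_eq_iff.1 ?_)).1
    simpa using hyproj 0 (by omega) (by omega)
  have hsucc : ∀ i : ℤ, -(n : ℤ) ≤ i → i < n →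
      y (i + 1) - codeAt s (i + 1) = flow D ε 1 (y i - codeAt s i) := fun i hi hi' => by
    have hstep : Step D ε (rep D (s i)) (rep D (s (i + 1))) (flow D ε 1 (y i) - y (i + 1)) := by
      refine ⟨?_, y i, hyrep i hi hi'.le, ?_⟩
      · rw [← proj_eq_iff, ← phi_proj, hyproj i hi hi'.le, hyproj (i + 1) (by omega) (by omega),
          add_comm, zpow_add, Equiv.Perm.mul_apply, zpow_one]
      · rw [sub_sub_cancel]
        exact hyrep (i + 1) (by omega) (by omega)
    have heq := hM.unique _ (s i).2 _ (s (i + 1)).2 _ _ hstep (hM.step_stepVector (hs i))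
    rw [codeAt_succ hD hsq he hM, ← heq, flow_sub]
    abel
  have hflow : ∀ i j : ℤ, -(n : ℤ) ≤ i → i ≤ j → j ≤ n →
      y j - codeAt s j = flow D ε (j - i) (y i - codeAt s i) := fun i j hi hij hj =>
    eq_flow_of_forall_succ hD hsq he (z := fun k => y k - codeAt s k) hij
      fun k hik hkj => hsucc k (hi.trans hik) (hkj.trans_le hj)
  rw [← hy0, ← codeAt_zero]
  refine norm_le_of_abs_flow_le hD hsq he (n := n) ?_ ?_
  · rw [hflow (-n) 0 le_rfl (by omega) (by omega), flow_flow hD hsq he, zero_sub, neg_neg,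
      neg_add_cancel, flow_zero]
    exact (norm_fst_le _).trans (hC s _ _ _ (hyrep (-n) le_rfl (by omega)))
  · rw [← sub_zero (n : ℤ), ← hflow 0 n (by omega) (by omega) le_rfl]
    exact (norm_snd_le _).trans (hC s _ _ _ (hyrep n (by omega) le_rfl))

lemma Generic.exists_code_eq {x : V} (hx : Generic D x) (hxF : x ∈ footprint D) :
    ∃ s ∈ Sig D ε, code s = x := by
  have hcover : ∀ k : ℤ, ∃ A : P0 D ε, (phi D ε ^ k) (proj D x) ∈ (A : Set (Torus D)) := by
    intro k
    obtain ⟨A, hA, h⟩ := hM.cover _ (hx.flow hD hsq he k)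
    exact ⟨⟨A, hA⟩, by rwa [phi_zpow_proj hD hsq he]⟩
  choose s hs using hcover
  have hSig : s ∈ Sig D ε := fun k => by
    refine ⟨_, hs k, ?_⟩
    have h := hs (k + 1)
    rwa [add_comm k, zpow_add, Equiv.Perm.mul_apply, zpow_one, add_comm] at h
  obtain ⟨C, hC⟩ := exists_norm_sub_code_le hD hsq he hM
  have hnorm : ‖x - code s‖ ≤ 0 := ge_of_tendsto' (tendsto_const_mul_inv_epsReal_pow he C) fun n =>
    hC s hSig n x ⟨hxF, mem_rect_iff.2 fun i => hs i⟩
  exact ⟨s, hSig, (sub_eq_zero.1 (norm_le_zero_iff.1 hnorm)).symm⟩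

lemma exists_proj_code_eq (x : Torus D) : ∃ s ∈ Sig D ε, proj D (code s) = x := by
  obtain ⟨v, hv, rfl⟩ := exists_mem_closedFootprint_proj_eq hD hsq x
  have hopen : IsOpen (footprint D) := (isOpen_planeR 0).union (isOpen_planeR 1)
  have hclosed : IsClosed (code '' Sig D ε) := (isCompact_code_image_Sig hD hsq he hM).isClosed
  have hgeneric : footprint D ∩ {v | Generic D v} ⊆ code '' Sig D ε := fun x hx =>
    hx.2.exists_code_eq hD hsq he hM hx.1
  have hfootprint : footprint D ⊆ code '' Sig D ε :=
    ((dense_generic hD hsq).open_subset_closure_inter hopen).trans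
      (closure_minimal hgeneric hclosed)
  obtain ⟨s, hs, hsv⟩ :=
    closure_minimal hfootprint hclosed (closedFootprint_subset_closure hD hsq hv)
  exact ⟨s, hs, congrArg (proj D) hsv⟩

end Coding

/-! ### Counting the words that code a dynamical ball -/

section Counting

open Dynamics Uniformity

variable {D : ℕ} {ε : (OK D)ˣ} (hD : 1 < D) (hsq : Squarefree D) (he : 1 < epsReal D ε)
include hD hsq he

lemma phi_iterate_proj (k : ℕ) (v : V) :
    (phi D ε)^[k] (proj D v) = proj D (flow D ε k v) := by
  rw [← phi_zpow_proj hD hsq he, zpow_natCast, Equiv.Perm.iterate_eq_pow]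

lemma eq_flow_of_norm_lt {w w' : V} (hw : ‖w‖ < (epsReal D ε + 1)⁻¹)
    (hw' : ‖w'‖ < (epsReal D ε + 1)⁻¹) (h : flow D ε 1 w - w' ∈ lattice D) :
    w' = flow D ε 1 w := by
  have : 0 < epsReal D ε := epsReal_pos he
  have hnorm : ‖flow D ε 1 w - w'‖ < 1 := by
    calc ‖flow D ε 1 w - w'‖ ≤ epsReal D ε * ‖w‖ + ‖w'‖ :=
          (norm_sub_le _ _).trans (by gcongr; exact norm_flow_le hD hsq he w)
      _ < epsReal D ε * (epsReal D ε + 1)⁻¹ + (epsReal D ε + 1)⁻¹ := by gcongr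
      _ = 1 := by field_simp
  refine (sub_eq_zero.1 (eq_zero_of_absNorm_lt_one hD hsq h ?_)).symm
  rw [absNorm, abs_mul]
  exact mul_lt_one_of_nonneg_of_lt_one_left (abs_nonneg _) ((norm_fst_le _).trans_lt hnorm)
    ((norm_snd_le _).trans hnorm.le)

lemma exists_close_lift {v x : V} {n : ℕ}
    (h : (proj D v, proj D x) ∈ dynEntourage (phi D ε)
      {p : Torus D × Torus D | dist p.1 p.2 < (epsReal D ε + 1)⁻¹} (n + 1)) :
    ∃ w : V, ‖w‖ < (epsReal D ε + 1)⁻¹ ∧ ‖flow D ε n w‖ < (epsReal D ε + 1)⁻¹ ∧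
      v - x - w ∈ lattice D := by
  have hlift : ∀ k : ℕ, k ≤ n → ∃ w : V, ‖w‖ < (epsReal D ε + 1)⁻¹ ∧
      flow D ε k (v - x) - w ∈ lattice D := by
    intro k hk
    have hdist : dist (proj D (flow D ε k v)) (proj D (flow D ε k x)) < (epsReal D ε + 1)⁻¹ := by
      rw [← phi_iterate_proj hD hsq he, ← phi_iterate_proj hD hsq he]
      exact mem_dynEntourage.1 h k (Nat.lt_succ_of_le hk)
    have hnorm : ‖proj D (flow D ε k (v - x))‖ < (epsReal D ε + 1)⁻¹ := by
      rw [flow_sub]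
      rwa [dist_eq_norm] at hdist
    obtain ⟨w, hw, hwn⟩ := QuotientAddGroup.norm_lt_iff.1 hnorm
    exact ⟨w, hwn, proj_eq_iff.1 hw.symm⟩
  choose! w hw hwmem using hlift
  have hflow : ∀ k : ℕ, k ≤ n → w k = flow D ε k (w 0) := by
    intro k
    induction k with
    | zero => simp [flow_zero]
    | succ k ih =>
      intro hk
      have hstep : flow D ε 1 (w k) - w (k + 1) ∈ lattice D := by
        have hdiff := (lattice D).sub_mem (hwmem (k + 1) hk)
          (flow_mem_lattice hD hsq he 1 (hwmem k (by omega)))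
        rwa [flow_sub 1, flow_flow hD hsq he, Nat.cast_succ, add_comm (1 : ℤ),
          sub_sub_sub_cancel_left] at hdiff
      rw [eq_flow_of_norm_lt hD hsq he (hw k (by omega)) (hw (k + 1) hk) hstep, ih (by omega),
        flow_flow hD hsq he, Nat.cast_succ, add_comm (1 : ℤ)]
  refine ⟨w 0, hw 0 (Nat.zero_le n), ?_, ?_⟩
  · rw [← hflow n le_rfl]
    exact hw n le_rfl
  · simpa [flow_zero] using hwmem 0 (Nat.zero_le n)

variable (hM : IsMarkov D ε)
include hM

-- The stable coordinate of a point of `rep (s 0)` and the unstable coordinate of a point of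
-- `rep (s n)`, together with the translation vector, determine a point whose orbit visits
-- `s 0, …, s n` in order.
lemma phi_zpow_proj_mem_of_endpoints {s : ℤ → P0 D ε} (hs : s ∈ Sig D ε) {x : V} {n : ℕ}
    (h0 : x.1 ∈ Prod.fst '' rep D (s 0))
    (hn : (flow D ε n x - (flow D ε n (code s) - codeAt s n)).2 ∈ Prod.snd '' rep D (s n)) :
    ∀ i ∈ Icc (0 : ℤ) n, (phi D ε ^ i) (proj D x) ∈ (s i : Set (Torus D)) := by
  have hrep := codeAt_add_flow_mem_rep hD hsq he hM hs (η := x - code s) (m := 0)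
    (Nat.cast_nonneg n) (by rwa [flow_zero, codeAt_zero, add_sub_cancel])
    (by rwa [flow_sub, add_sub_left_comm, ← add_sub_assoc, ← sub_sub_eq_add_sub])
  intro i hi
  have hmem := (hrep i hi).2
  rwa [mem_preimage, proj_codeAt_add_flow hD hsq he hM, add_sub_cancel] at hmem

lemma eqOn_of_same_translation {s s' : ℤ → P0 D ε} (hs : s ∈ Sig D ε) (hs' : s' ∈ Sig D ε) {n : ℕ}
    (h0 : s 0 = s' 0) (hn : s n = s' n)
    (h : flow D ε n (code s) - codeAt s n = flow D ε n (code s') - codeAt s' n) :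
    EqOn s s' (Icc 0 n) := by
  obtain ⟨v, hv, -⟩ := (hM.step_stepVector (hs 0)).2
  obtain ⟨w, hw, -⟩ := (hM.step_stepVector (hs n)).2
  let q : V := flow D ε n (code s) - codeAt s n
  let x : V := (v.1, (flow D ε (-n) (w + q)).2)
  have hx : (flow D ε n x - q).2 = w.2 := by
    have hsnd : (flow D ε n x).2 = (flow D ε n (flow D ε (-n) (w + q))).2 := rfl
    rw [Prod.snd_sub, hsnd, flow_flow hD hsq he, add_neg_cancel, flow_zero, Prod.snd_add,
      add_sub_cancel_right]
  intro i hi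
  have hmem := phi_zpow_proj_mem_of_endpoints hD hsq he hM hs (x := x) ⟨v, hv, rfl⟩
    ⟨w, hw, hx.symm⟩ i hi
  have hmem' := phi_zpow_proj_mem_of_endpoints hD hsq he hM hs' (x := x) ⟨v, h0 ▸ hv, rfl⟩
    ⟨w, hn ▸ hw, by rw [← h]; exact hx.symm⟩ i hi
  exact Subtype.ext (hM.disjoint _ (s i).2 _ (s' i).2 _ hmem hmem')

lemma exists_translation_eq {C : ℝ} (hC : ∀ s : ℤ → P0 D ε, ‖code s‖ ≤ C) {y z : V}
    (hy : y ∈ closedFootprint D) (hz : z ∈ closedFootprint D) {n : ℕ}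
    (hzy : proj D z = proj D (flow D ε n y)) {s : ℤ → P0 D ε}
    (h : (proj D (code s), proj D y) ∈ dynEntourage (phi D ε)
      {p : Torus D × Torus D | dist p.1 p.2 < (epsReal D ε + 1)⁻¹} (n + 1)) :
    ∃ p ∈ (lattice D : Set V) ∩ Metric.closedBall 0 (C + (1 + alphaReal D + negAlphaConj D) + 1),
    ∃ q ∈ (lattice D : Set V) ∩ Metric.closedBall 0 (C + (1 + alphaReal D + negAlphaConj D) + 1),
      flow D ε n (code s) - codeAt s n = flow D ε n y - z + flow D ε n p - q := by
  have : 0 < epsReal D ε := epsReal_pos he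
  have hinv : (epsReal D ε + 1)⁻¹ ≤ 1 := inv_le_one_of_one_le₀ (by linarith)
  obtain ⟨w, hw, hwn, hmem⟩ := exists_close_lift hD hsq he h
  have hball : ∀ a b c : V, ‖a‖ ≤ C → b ∈ closedFootprint D → ‖c‖ < (epsReal D ε + 1)⁻¹ →
      a - b - c ∈ Metric.closedBall 0 (C + (1 + alphaReal D + negAlphaConj D) + 1) := by
    intro a b c ha hb hc
    rw [mem_closedBall_zero_iff]
    exact (norm_sub_le _ _).trans (add_le_add ((norm_sub_le _ _).trans
      (add_le_add ha (norm_le_of_mem_closedFootprint hD hsq hb))) (hc.le.trans hinv))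
  refine ⟨code s - y - w, ⟨hmem, hball _ _ _ (hC s) hy hw⟩, codeAt s n - z - flow D ε n w,
    ⟨?_, hball _ _ _ (hC _) hz hwn⟩, ?_⟩
  · have hcode := flow_codeAt_sub_mem_lattice hD hsq he hM s 0 n
    rw [zero_add, codeAt_zero] at hcode
    have hsum := (lattice D).sub_mem ((lattice D).sub_mem (flow_mem_lattice hD hsq he n hmem)
      (proj_eq_iff.1 hzy)) hcode
    have heq : codeAt s n - z - flow D ε n w = flow D ε n (code s - y - w) -
        (z - flow D ε n y) - (flow D ε n (code s) - codeAt s n) := by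
      rw [flow_sub, flow_sub]
      abel
    rwa [heq]
  · rw [flow_sub, flow_sub]
    abel

lemma exists_encard_words_le : ∃ C : ℕ, C ≠ 0 ∧ ∃ W ∈ 𝓤 (Torus D),
    ∀ S ⊆ Sig D ε, ∀ m : ℕ, m ≠ 0 → ∀ x, ((Ico (0 : ℤ) m).domRestrict ''
      {s ∈ S | (proj D (code s), x) ∈ dynEntourage (phi D ε) W m}).encard ≤ C := by
  have := hM.finite.to_subtype
  have : 0 < epsReal D ε := epsReal_pos he
  obtain ⟨C, hC⟩ := exists_norm_code_le hD hsq he hM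
  let L : Set V :=
    (lattice D : Set V) ∩ Metric.closedBall 0 (C + (1 + alphaReal D + negAlphaConj D) + 1)
  have hL : L.Finite := finite_lattice_inter_closedBall hD hsq _
  let data : Set (P0 D ε × P0 D ε × V × V) := univ ×ˢ univ ×ˢ L ×ˢ L
  have hdata : data.Finite := finite_univ.prod (finite_univ.prod (hL.prod hL))
  refine ⟨data.ncard + 1, by omega, {p | dist p.1 p.2 < (epsReal D ε + 1)⁻¹},
    Metric.dist_mem_uniformity (by positivity), fun S hS m hm x => ?_⟩
  obtain ⟨n, rfl⟩ := Nat.exists_eq_succ_of_ne_zero hm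
  obtain ⟨y, hy, rfl⟩ := exists_mem_closedFootprint_proj_eq hD hsq x
  obtain ⟨z, hz, hzy⟩ := exists_mem_closedFootprint_proj_eq hD hsq (proj D (flow D ε n y))
  choose! p hp q hq htrans using fun s => exists_translation_eq hD hsq he hM hC hy hz hzy (s := s)
  refine (encard_image_le_of_determined (d := fun s => (s 0, s n, p s, q s)) ?_).trans ?_
  · rintro s ⟨hsS, hs⟩ s' ⟨hsS', hs'⟩ hd
    simp only [Prod.mk.injEq] at hd
    obtain ⟨h0, hn, hpp, hqq⟩ := hd
    have heq := eqOn_of_same_translation hD hsq he hM (hS hsS) (hS hsS') h0 hn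
      (by rw [htrans s hs, htrans s' hs', hpp, hqq])
    exact funext fun i => heq ⟨i.2.1, by have := i.2.2; omega⟩
  · have himage : ((fun s => (s 0, s n, p s, q s)) '' {s ∈ S | (proj D (code s), proj D y) ∈
        dynEntourage (phi D ε) {p | dist p.1 p.2 < (epsReal D ε + 1)⁻¹} (n + 1)}) ⊆ data := by
      rintro _ ⟨s, ⟨-, hs⟩, rfl⟩
      exact ⟨trivial, trivial, hp s hs, hq s hs⟩
    calc _ ≤ data.encard := encard_le_encard himage
      _ = data.ncard := hdata.cast_ncard_eq.symm
      _ ≤ _ := by exact_mod_cast Nat.le_succ _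

end Counting

/-! ### The Euclidean minimum -/

section Euclidean

variable {D : ℕ} {ε : (OK D)ˣ}

lemma bddBelow_absNorm (v : V) : BddBelow (range fun q : lattice D => absNorm (v - q)) :=
  ⟨0, by rintro _ ⟨q, rfl⟩; exact abs_nonneg _⟩

lemma MV_nonneg (v : V) : 0 ≤ MV D v := le_ciInf fun _ => abs_nonneg _

lemma MV_lt_iff {v : V} {t : ℝ} : MV D v < t ↔ ∃ q ∈ lattice D, absNorm (v - q) < t := by
  rw [MV, ciInf_lt_iff (bddBelow_absNorm v), Subtype.exists]
  simp only [exists_prop]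

lemma MV_le_absNorm_sub (v : V) {q : V} (hq : q ∈ lattice D) : MV D v ≤ absNorm (v - q) :=
  ciInf_le (bddBelow_absNorm v) ⟨q, hq⟩

lemma absNorm_sub_le {v y : V} {B η : ℝ} (hv : ‖v‖ ≤ B) (hy : ‖y‖ ≤ η) :
    absNorm (v - y) ≤ absNorm v + η * (2 * B + η) := by
  have hv1 : |v.1| ≤ B := (norm_fst_le v).trans hv
  have hv2 : |v.2| ≤ B := (norm_snd_le v).trans hv
  have hy1 : |y.1| ≤ η := (norm_fst_le y).trans hy
  have hy2 : |y.2| ≤ η := (norm_snd_le y).trans hy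
  calc absNorm (v - y) = |v.1 * v.2 - (v.1 * y.2 + y.1 * v.2 - y.1 * y.2)| := by
        rw [absNorm, Prod.fst_sub, Prod.snd_sub]
        ring_nf
    _ ≤ |v.1 * v.2| + (|v.1| * |y.2| + |y.1| * |v.2| + |y.1| * |y.2|) := by
        simp only [← abs_mul]
        exact (abs_sub _ _).trans (add_le_add_right ((abs_sub _ _).trans
          (add_le_add_left (abs_add_le _ _) _)) _)
    _ ≤ absNorm v + (B * η + η * B + η * η) := by
        have := (abs_nonneg _).trans hv1
        have := (abs_nonneg _).trans hy1
        rw [absNorm]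
        gcongr
    _ = absNorm v + η * (2 * B + η) := by ring

lemma abs_pow_mul_div_pow_sub_one_le {a : ℝ} (ha : |a| < 1) {n : ℕ} (hn : n ≠ 0) (x : ℝ) (k : ℕ) :
    |a ^ k * (x / (a ^ n - 1))| ≤ |x| / (1 - |a|) := by
  have hpos : 0 < 1 - |a| := sub_pos.2 ha
  have hle : 1 - |a| ≤ |a ^ n - 1| := by
    have habs := abs_sub_abs_le_abs_sub 1 (a ^ n)
    rw [abs_one, abs_pow, abs_sub_comm] at habs
    linarith [pow_le_of_le_one (abs_nonneg a) ha.le hn]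
  rw [abs_mul, abs_pow, abs_div]
  exact (mul_le_of_le_one_left (by positivity) (pow_le_one₀ (abs_nonneg a) ha.le)).trans
    (div_le_div_of_nonneg_left (abs_nonneg x) hpos hle)

lemma abs_pow_mul_div_pow_sub_one_le_of_one_lt {a : ℝ} (ha : 1 < a) {k n : ℕ} (hn : n ≠ 0)
    (hk : k ≤ n) (x : ℝ) : |a ^ k * (x / (a ^ n - 1))| ≤ |x| / (1 - a⁻¹) := by
  have hinv : |a⁻¹| = a⁻¹ := abs_of_pos (by positivity)
  have hne : a ^ n - 1 ≠ 0 := (sub_pos.2 (one_lt_pow₀ ha hn)).ne'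
  have : a⁻¹ ^ n - 1 ≠ 0 :=
    (sub_neg.2 (pow_lt_one₀ (by positivity) (inv_lt_one_of_one_lt₀ ha) hn)).ne
  have heq : a ^ k * (x / (a ^ n - 1)) = a⁻¹ ^ (n - k) * (-x / (a⁻¹ ^ n - 1)) := by
    have hsplit : a⁻¹ ^ (n - k) = a ^ k * a⁻¹ ^ n := by
      rw [inv_pow, inv_pow, ← Nat.sub_add_cancel hk, pow_add, Nat.add_sub_cancel]
      field_simp
    have hprod : a⁻¹ ^ n * (a ^ n - 1) = -(a⁻¹ ^ n - 1) := by
      rw [mul_sub, ← mul_pow, inv_mul_cancel₀ (by positivity), one_pow]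
      ring
    rw [hsplit, mul_assoc, mul_div_assoc', ← neg_neg (a⁻¹ ^ n - 1), ← hprod]
    field_simp
  rw [heq]
  simpa only [hinv, abs_neg] using
    abs_pow_mul_div_pow_sub_one_le (hinv.trans_lt (inv_lt_one_of_one_lt₀ ha)) hn (-x) (n - k)

variable (hD : 1 < D) (hsq : Squarefree D)
include hD hsq

lemma MV_le (v : V) : MV D v ≤ (1 + alphaReal D + negAlphaConj D) ^ 2 := by
  obtain ⟨q, hq, hvq⟩ := exists_sub_mem_closedFootprint hD hsq v
  have hnorm := norm_le_of_mem_closedFootprint hD hsq hvq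
  refine (MV_le_absNorm_sub v hq).trans ?_
  rw [absNorm, abs_mul, sq]
  exact mul_le_mul ((norm_fst_le _).trans hnorm) ((norm_snd_le _).trans hnorm) (abs_nonneg _)
    ((norm_nonneg _).trans hnorm)

lemma MV_emb_le_M1 (x : K D) : MV D (emb D x) ≤ M1 D := by
  refine le_ciSup (f := fun a : K D => M D (proj D (emb D a)))
    ⟨(1 + alphaReal D + negAlphaConj D) ^ 2, ?_⟩ x
  rintro _ ⟨a, rfl⟩
  exact MV_le hD hsq _

lemma M1_nonneg : 0 ≤ M1 D := (MV_nonneg _).trans (MV_emb_le_M1 hD hsq 0)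

variable (he : 1 < epsReal D ε)
include he

lemma MV_flow (i : ℤ) (v : V) : MV D (flow D ε i v) = MV D v := by
  have hle : ∀ (i : ℤ) (v : V), MV D (flow D ε i v) ≤ MV D v := by
    refine fun i v => le_ciInf fun q => ?_
    rw [← absNorm_flow hD hsq (ε := ε) i, flow_sub]
    exact MV_le_absNorm_sub _ (flow_mem_lattice hD hsq he i q.2)
  refine le_antisymm (hle i v) ?_
  simpa only [flow_flow hD hsq he, neg_add_cancel, flow_zero] using hle (-i) (flow D ε i v)

lemma exists_norm_flow_lt {c : ℝ} (hc : 0 < c) {w : V} (hw : absNorm w < c) :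
    ∃ k : ℤ, ‖flow D ε k w‖ < √(epsReal D ε * c) := by
  have hpos := epsReal_pos he
  set B := √(epsReal D ε * c)
  have hB : 0 < B := Real.sqrt_pos.2 (by positivity)
  have hB2 : B * B = epsReal D ε * c := Real.mul_self_sqrt (by positivity)
  simp only [Prod.norm_def, max_lt_iff, Real.norm_eq_abs]
  rcases eq_or_ne w.2 0 with h | h
  · obtain ⟨n, hn⟩ := ((tendsto_const_mul_inv_epsReal_pow he |w.1|).eventually
      (gt_mem_nhds hB)).exists
    refine ⟨n, ?_, by simpa [flow, h] using hB⟩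
    rwa [flow, zpow_natCast, abs_mul, abs_pow, abs_epsConj hD hsq he, mul_comm]
  · have hw2 : 0 < |w.2| := abs_pos.2 h
    obtain ⟨k, hlt, hle⟩ := exists_mem_Ioc_zpow (div_pos hB hw2) he
    have hsnd : |(flow D ε k w).2| = epsReal D ε ^ k * |w.2| := by
      rw [flow, abs_mul, abs_zpow, abs_of_pos hpos]
    rw [lt_div_iff₀ hw2, ← hsnd] at hlt
    rw [div_le_iff₀ hw2, zpow_add_one₀ hpos.ne', mul_right_comm, ← hsnd] at hle
    refine ⟨k, ?_, hlt⟩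
    by_contra! hcon
    have hnorm : |(flow D ε k w).1| * |(flow D ε k w).2| < c := by
      rw [← abs_mul]
      exact (absNorm_flow hD hsq k w).trans_lt hw
    have hBB : B * B ≤ |(flow D ε k w).1| * (|(flow D ε k w).2| * epsReal D ε) := by gcongr
    rw [hB2, ← mul_assoc, mul_comm _ (epsReal D ε)] at hBB
    exact hnorm.not_ge (le_of_mul_le_mul_left hBB hpos)

lemma exists_flow_sub_self_eq {n : ℕ} (hn : n ≠ 0) (w : V) : ∃ y : V, flow D ε n y - y = w ∧
    ∀ k : ℕ, k ≤ n → ‖flow D ε k y‖ ≤ ‖w‖ / (1 - (epsReal D ε)⁻¹) := by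
  have hlt := abs_epsConj_lt_one hD hsq he
  have hpos : 0 < 1 - (epsReal D ε)⁻¹ := sub_pos.2 (inv_lt_one_of_one_lt₀ he)
  have hs : epsConj D ε ^ n - 1 ≠ 0 := sub_ne_zero.2 fun h =>
    (pow_lt_one₀ (abs_nonneg _) hlt hn).ne (by rw [← abs_pow, h, abs_one])
  have hu : epsReal D ε ^ n - 1 ≠ 0 := (sub_pos.2 (one_lt_pow₀ he hn)).ne'
  refine ⟨(w.1 / (epsConj D ε ^ n - 1), w.2 / (epsReal D ε ^ n - 1)), ?_, fun k hk => ?_⟩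
  · simp only [flow, zpow_natCast, Prod.mk_sub_mk, ← sub_one_mul, mul_div_cancel₀ _ hs,
      mul_div_cancel₀ _ hu]
  · rw [flow, Prod.norm_mk, max_le_iff, zpow_natCast, zpow_natCast]
    constructor
    · refine (abs_pow_mul_div_pow_sub_one_le hlt hn w.1 k).trans ?_
      rw [abs_epsConj hD hsq he]
      exact div_le_div_of_nonneg_right (norm_fst_le w) hpos.le
    · exact (abs_pow_mul_div_pow_sub_one_le_of_one_lt he hn hk w.2).trans
        (div_le_div_of_nonneg_right (norm_snd_le w) hpos.le)

lemma exists_almost_return (v : V) {δ : ℝ} (hδ : 0 < δ) : ∃ i n : ℕ, n ≠ 0 ∧ ∃ x x' : V,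
    proj D x = proj D (flow D ε i v) ∧ proj D x' = proj D (flow D ε n x) ∧ ‖x - x'‖ < δ := by
  choose x hxF hx using fun k : ℕ =>
    exists_mem_closedFootprint_proj_eq hD hsq (proj D (flow D ε k v))
  obtain ⟨a, -, ψ, hψ, ha⟩ := isCompact_closedFootprint.tendsto_subseq hxF
  have hlim : Tendsto (fun k => ‖x (ψ k) - x (ψ (k + 1))‖) atTop (𝓝 0) := by
    simpa using (ha.sub (ha.comp (tendsto_add_atTop_nat 1))).norm
  obtain ⟨k, hk⟩ := (hlim.eventually (gt_mem_nhds hδ)).exists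
  have hlt : ψ k < ψ (k + 1) := hψ (Nat.lt_succ_self k)
  refine ⟨ψ k, ψ (k + 1) - ψ k, by omega, x (ψ k), x (ψ (k + 1)), hx _, ?_, hk⟩
  rw [← phi_zpow_proj hD hsq he, hx, hx, phi_zpow_proj hD hsq he, flow_flow hD hsq he,
    Nat.cast_sub hlt.le, sub_add_cancel]

-- The closing lemma: an almost return of the orbit of `v` is corrected to a periodic point `z`.
lemma exists_periodic_shadow (v : V) {η : ℝ} (hη : 0 < η) : ∃ i n : ℕ, n ≠ 0 ∧ ∃ y z : V,
    flow D ε n z - z ∈ lattice D ∧ flow D ε i v + y - z ∈ lattice D ∧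
      ∀ k : ℕ, k ≤ n → ‖flow D ε k y‖ ≤ η := by
  have hpos : 0 < 1 - (epsReal D ε)⁻¹ := sub_pos.2 (inv_lt_one_of_one_lt₀ he)
  obtain ⟨i, n, hn, x, x', hx, hx', hlt⟩ := exists_almost_return hD hsq he v (mul_pos hη hpos)
  obtain ⟨y, hy, hyk⟩ := exists_flow_sub_self_eq hD hsq he hn (x - x')
  refine ⟨i, n, hn, y, x + y, ?_, ?_, fun k hk => (hyk k hk).trans ((div_le_iff₀ hpos).2 hlt.le)⟩
  · have heq : flow D ε n (x + y) - (x + y) = flow D ε n x - x' := by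
      rw [flow_add, add_sub_add_comm, hy, sub_add_sub_cancel]
    rw [heq]
    exact proj_eq_iff.1 hx'.symm
  · rw [add_sub_add_right_eq_sub]
    exact proj_eq_iff.1 hx.symm

lemma flow_sub_flow_emod_mem_lattice {n : ℤ} {z : V} (h : flow D ε n z - z ∈ lattice D) (k : ℤ) :
    flow D ε k z - flow D ε (k % n) z ∈ lattice D := by
  rw [← proj_eq_iff, ← phi_zpow_proj hD hsq he] at h ⊢
  rw [← phi_zpow_proj hD hsq he]
  nth_rw 1 [← Int.emod_add_mul_ediv k n]
  rw [zpow_add, zpow_mul, Equiv.Perm.mul_apply, Equiv.Perm.zpow_apply_eq_self_of_apply_eq_self h]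

-- A periodic point `z` that shadows the orbit of `v` lies in `K`, so some lattice translate of it
-- has norm almost `M₁`; moving that translate along the flow into a bounded box makes the shadowing
-- error harmless.
lemma MV_lt_M1_add_one (v : V) : MV D v < M1 D + 1 := by
  have hc : 0 < M1 D + 1 := by linarith [M1_nonneg hD hsq]
  set B := √(epsReal D ε * (M1 D + 1))
  have hB : 0 ≤ B := Real.sqrt_nonneg _
  obtain ⟨η, hη, hηB⟩ : ∃ η > 0, η * (2 * B + η) ≤ 1 / 2 := by
    refine ⟨1 / (2 * (2 * B + 1)), by positivity, ?_⟩
    rw [div_mul_eq_mul_div, one_mul, div_le_div_iff₀ (by positivity) two_pos]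
    have : 1 / (2 * (2 * B + 1)) ≤ 1 := (div_le_one (by positivity)).2 (by linarith)
    linarith
  obtain ⟨i, n, hn, y, z, hper, hshadow, hy⟩ := exists_periodic_shadow hD hsq he v hη
  obtain ⟨a, rfl⟩ := mem_range_emb_of_periodic he hn hper
  obtain ⟨q, hq, hqnorm⟩ := MV_lt_iff.1
    ((MV_emb_le_M1 hD hsq a).trans_lt (lt_add_of_pos_right (M1 D) one_half_pos))
  obtain ⟨k, hk⟩ := exists_norm_flow_lt hD hsq he hc (hqnorm.trans (by linarith))
  have hn' : (n : ℤ) ≠ 0 := by exact_mod_cast hn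
  obtain ⟨r, hr⟩ := Int.eq_ofNat_of_zero_le (Int.emod_nonneg k hn')
  have hrn : r ≤ n := by
    have := Int.emod_lt_of_pos k (by omega : (0 : ℤ) < n)
    omega
  have hmod := flow_sub_flow_emod_mem_lattice hD hsq he hper k
  rw [hr] at hmod
  have hmem : flow D ε r (flow D ε i v) - (flow D ε k (emb D a - q) - flow D ε r y) ∈
      lattice D := by
    have hsum := (lattice D).add_mem ((lattice D).sub_mem
      (flow_mem_lattice hD hsq he r hshadow) hmod) (flow_mem_lattice hD hsq he k hq)
    convert hsum using 1
    rw [flow_sub, flow_sub, flow_add]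
    abel
  calc MV D v = MV D (flow D ε k (emb D a - q) - flow D ε r y) := by
        rw [← MV_congr D _ _ hmem, MV_flow hD hsq he, MV_flow hD hsq he]
    _ ≤ absNorm (flow D ε k (emb D a - q) - flow D ε r y) := by
        simpa only [sub_zero] using MV_le_absNorm_sub _ (lattice D).zero_mem
    _ ≤ absNorm (emb D a - q) + η * (2 * B + η) := by
        rw [← absNorm_flow hD hsq (ε := ε) k (emb D a - q)]
        exact absNorm_sub_le hk.le (hy r hrn)
    _ < M1 D + 1 := by linarith

end Euclidean

/-! ### Trapping rectangles -/

section Trapping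

open Dynamics Uniformity

variable {D : ℕ} {ε : (OK D)ˣ}

/-- The strings of `Σ` that code points of `X_t`. -/
def codesX (D : ℕ) (ε : (OK D)ˣ) (t : ℝ) : Set (ℤ → P0 D ε) := {s ∈ Sig D ε | t ≤ MV D (code s)}

lemma Rbig_eq_ball : Rbig D ε = Metric.ball 0 √(epsReal D ε * (M1 D + 1)) := by
  ext v
  rw [mem_ball_zero_iff, Prod.norm_def, max_lt_iff]
  rfl

lemma IK_finite (hD : 1 < D) (hsq : Squarefree D) : (IK D ε).Finite := by
  refine ((finite_lattice_inter_closedBall hD hsq (1 + alphaReal D + negAlphaConj D +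
    √(epsReal D ε * (M1 D + 1)))).preimage embO_injective.injOn).subset ?_
  rintro q ⟨R, -, v, hv, hvq⟩
  rw [Rbig_eq_ball, mem_ball_zero_iff] at hvq
  refine ⟨⟨q, rfl⟩, mem_closedBall_zero_iff.2 ?_⟩
  rw [← sub_sub_cancel v (embO D q)]
  exact (norm_sub_le _ _).trans
    (add_le_add (norm_le_of_mem_closedFootprint hD hsq (rep_subset_closedFootprint R hv)) hvq.le)

lemma mapsTo_shift_SigAvoid (n : ℕ) (C : Set (Set (Torus D))) :
    MapsTo shift (SigAvoid D ε n C) (SigAvoid D ε n C) := by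
  rintro s ⟨hs, havoid⟩
  refine ⟨fun k => hs (k + 1), fun w hw ⟨k, hk⟩ => havoid w hw ⟨k + 1, fun i => ?_⟩⟩
  rw [← hk i, shift, add_right_comm]

lemma translate_mem_Sig {s : ℤ → P0 D ε} (hs : s ∈ Sig D ε) (k : ℤ) :
    (fun i => s (i + k)) ∈ Sig D ε := fun i => by
  simpa only [add_right_comm] using hs (i + k)

lemma centralWord_translate (s : ℤ → P0 D ε) (k : ℤ) (n : ℕ) (i : Icc (-(n : ℤ)) n) :
    s (k + i) = centralWord (fun j => s (j + k)) n i := by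
  rw [centralWord, add_comm]

lemma rep_rect_centralWord_zero_subset (s : ℤ → P0 D ε) :
    rep D (rect D ε 0 (centralWord s 0)) ⊆ rep D (s 0) := fun _ hx =>
  ⟨hx.1, mem_rect_iff.1 hx.2 ⟨0, by simp⟩⟩

lemma isOpen_U (t : ℝ) (I : Set (OK D)) : IsOpen (U D t I) := by
  refine isOpen_biUnion fun q _ => isOpen_lt ?_ continuous_const
  unfold absNorm
  fun_prop

variable (hD : 1 < D) (hsq : Squarefree D) (he : 1 < epsReal D ε) (hM : IsMarkov D ε)
include hD hsq he hM

lemma MV_codeAt (s : ℤ → P0 D ε) (k : ℤ) : MV D (codeAt s k) = MV D (code s) := by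
  have hmem := flow_codeAt_sub_mem_lattice hD hsq he hM s 0 k
  rw [codeAt_zero, zero_add] at hmem
  rw [← MV_congr D _ _ hmem, MV_flow hD hsq he]

lemma codeAt_mem_closure_rep {s : ℤ → P0 D ε} (hs : s ∈ Sig D ε) (k : ℤ) :
    codeAt s k ∈ closure (rep D (s k)) := by
  have hmem := closure_mono (rep_rect_centralWord_zero_subset _)
    (code_mem_closure_rep_rect hD hsq he hM (translate_mem_Sig hs k) 0)
  rwa [zero_add] at hmem

lemma codesX_subset_SigAvoid (t : ℝ) (I : Set (OK D)) (n : ℕ) :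
    codesX D ε t ⊆ SigAvoid D ε n (T D ε n t I) := by
  rintro s ⟨hs, hst⟩
  refine ⟨hs, fun w hw ⟨k, hk⟩ => ?_⟩
  obtain rfl : centralWord (fun i => s (i + k)) n = w :=
    funext fun i => (centralWord_translate s k n i).symm.trans (hk i)
  obtain ⟨q, -, hq⟩ := mem_iUnion₂.1
    (hw.2 (code_mem_closure_rep_rect hD hsq he hM (translate_mem_Sig hs k) n))
  rw [← MV_codeAt hD hsq he hM s k] at hst
  exact (hst.trans (MV_le_absNorm_sub _ ⟨q, rfl⟩)).not_gt hq

-- The bound `M < M₁ + 1` lets the flow carry the point to within the box of `Rbig` of a lattice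
-- point, which is then one of the finitely many points of `I_K`.
lemma exists_codeAt_mem_U {t : ℝ} {I : Set (OK D)} (hI : IK D ε ⊆ I) {s : ℤ → P0 D ε}
    (hs : s ∈ Sig D ε) (hst : MV D (code s) < t) : ∃ k, codeAt s k ∈ U D t I := by
  have hc : 0 < M1 D + 1 := by linarith [M1_nonneg hD hsq]
  obtain ⟨q, hq, hqnorm⟩ := MV_lt_iff.1 (lt_min hst (MV_lt_M1_add_one hD hsq he (code s)))
  obtain ⟨hqt, hqM⟩ := lt_min_iff.1 hqnorm
  obtain ⟨k, hk⟩ := exists_norm_flow_lt hD hsq he hc hqM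
  have hmem := flow_codeAt_sub_mem_lattice hD hsq he hM s 0 k
  rw [codeAt_zero, zero_add] at hmem
  obtain ⟨r, hr⟩ : ∃ r : OK D, codeAt s k - embO D r = flow D ε k (code s - q) := by
    obtain ⟨r, hr⟩ := (lattice D).sub_mem (flow_mem_lattice hD hsq he k hq) hmem
    refine ⟨r, ?_⟩
    change codeAt s k - (embO D).toAddMonoidHom r = _
    rw [hr, flow_sub]
    abel
  have hopen : IsOpen {v : V | v - embO D r ∈ Rbig D ε} := by
    rw [Rbig_eq_ball]
    exact Metric.isOpen_ball.preimage (continuous_id.sub continuous_const)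
  have hbox : codeAt s k - embO D r ∈ Rbig D ε := by
    rwa [hr, Rbig_eq_ball, mem_ball_zero_iff]
  obtain ⟨v, hv, hvr⟩ := mem_closure_iff.1 (codeAt_mem_closure_rep hD hsq he hM hs k) _ hopen hbox
  refine ⟨k, mem_iUnion₂.2 ⟨r, hI ⟨_, (s k).2, v, hvr, hv⟩, ?_⟩⟩
  rwa [mem_ofPred_eq, hr, absNorm_flow hD hsq]

lemma exists_eventually_closure_rep_rect_subset {O : Set V} (hO : IsOpen O) {s : ℤ → P0 D ε}
    (hs : code s ∈ O) : ∃ j : ℕ, ∀ᶠ n : ℕ in atTop, ∀ s' ∈ Sig D ε,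
      EqOn s s' (Icc (-(j : ℤ)) j) → closure (rep D (rect D ε n (centralWord s' n))) ⊆ O := by
  obtain ⟨ρ, hρ, hball⟩ := Metric.isOpen_iff.1 hO _ hs
  obtain ⟨j, hj⟩ := exists_norm_code_sub_lt hD hsq he hM (half_pos hρ)
  obtain ⟨C, hC⟩ := exists_norm_sub_code_le hD hsq he hM
  refine ⟨j, ?_⟩
  filter_upwards [(tendsto_const_mul_inv_epsReal_pow he C).eventually (gt_mem_nhds (half_pos hρ))]
    with n hn s' hs' heq
  have hsub : rep D (rect D ε n (centralWord s' n)) ⊆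
      Metric.closedBall (code s') (C * (epsReal D ε)⁻¹ ^ n) := fun x hx => by
    rw [mem_closedBall_iff_norm]
    exact hC _ hs' n x hx
  refine (closure_minimal hsub Metric.isClosed_closedBall).trans
    ((Metric.closedBall_subset_ball' ?_).trans hball)
  rw [dist_comm, dist_eq_norm]
  linarith [hj s s' heq]

lemma eventually_not_eqOn {t : ℝ} {I : Set (OK D)} (hI : IK D ε ⊆ I) {s : ℤ → P0 D ε}
    (hs : s ∉ codesX D ε t) : ∃ j : ℕ, ∀ᶠ n in atTop, ∀ s' ∈ SigAvoid D ε n (T D ε n t I),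
      ¬ EqOn s s' (Icc (-(j : ℤ)) j) := by
  by_cases hsig : s ∈ Sig D ε
  · obtain ⟨k, hk⟩ := exists_codeAt_mem_U hD hsq he hM hI hsig
      (lt_of_not_ge fun h => hs ⟨hsig, h⟩)
    obtain ⟨j, hj⟩ := exists_eventually_closure_rep_rect_subset hD hsq he hM (isOpen_U t I) hk
    refine ⟨j + k.natAbs, ?_⟩
    filter_upwards [hj] with n hn s' hs' heq
    have hs'k := translate_mem_Sig hs'.1 k
    refine hs'.2 _ ⟨rect_centralWord_mem_P hD hsq he hM hs'k n, hn _ hs'k fun i hi => ?_⟩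
      ⟨k, centralWord_translate s' k n⟩
    obtain ⟨hi1, hi2⟩ := hi
    exact heq ⟨by omega, by omega⟩
  · obtain ⟨k, hk⟩ := not_forall.1 hsig
    refine ⟨k.natAbs + 1, Eventually.of_forall fun n s' hs' heq => hk ?_⟩
    rw [heq ⟨by omega, by omega⟩, heq ⟨by omega, by omega⟩]
    exact hs'.1 k

lemma proj_code_image_codesX (t : ℝ) : (fun s => proj D (code s)) '' codesX D ε t = X D t := by
  ext x
  constructor
  · rintro ⟨s, ⟨-, hs⟩, rfl⟩
    exact hs
  · intro hx
    obtain ⟨s, hs, rfl⟩ := exists_proj_code_eq hD hsq he hM x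
    exact ⟨s, ⟨hs, hx⟩, rfl⟩

lemma coverEntropy_X_le (t : ℝ) :
    coverEntropy (phi D ε) (X D t) ≤ shiftEntropy (codesX D ε t) := by
  rw [← proj_code_image_codesX hD hsq he hM]
  refine coverEntropy_image_le_shiftEntropy (semiconj_proj_code hD hsq he hM) (fun W hW => ?_) _
  obtain ⟨δ, hδ, hW⟩ := Metric.mem_uniformity_dist.1 hW
  obtain ⟨j, hj⟩ := exists_norm_code_sub_lt hD hsq he hM hδ
  refine ⟨j, fun s s' heq => hW ?_⟩
  rw [dist_eq_norm]
  exact (QuotientAddGroup.norm_mk_le_norm (S := lattice D) (m := code s - code s')).trans_lt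
    (hj s s' heq)

end Trapping

end RealQuad

end

theorem corollary1_general (D : ℕ) (hD : 1 < D) (hsq : Squarefree D)
    (ε : (RealQuad.OK D)ˣ) (hε : 1 < (((ε : RealQuad.OK D) : RealQuad.K D) : ℝ))
    (hfund : D = 5 → RealQuad.IsFundamentalUnit D ε) :
    (RealQuad.IK D ε).Finite ∧
    ∀ t : ℝ, ∀ I : Set (RealQuad.OK D), RealQuad.IK D ε ⊆ I →
      Filter.Tendsto
        (fun n : ℕ => RealQuad.shiftEntropy
          (RealQuad.SigAvoid D ε n (RealQuad.T D ε n t I)))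
        Filter.atTop
        (nhds (Dynamics.coverEntropy (RealQuad.phi D ε) (RealQuad.X D t))) := by
  have hM := RealQuad.isMarkov hD hsq hε hfund
  have := hM.finite.to_subtype
  obtain ⟨C, hC, W, hW, hcard⟩ := RealQuad.exists_encard_words_le hD hsq hε hM
  refine ⟨RealQuad.IK_finite hD hsq, fun t I hI => ?_⟩
  exact RealQuad.tendsto_shiftEntropy
    (fun n => RealQuad.mapsTo_shift_SigAvoid n _)
    (RealQuad.codesX_subset_SigAvoid hD hsq hε hM t I)
    (fun s => RealQuad.eventually_not_eqOn hD hsq hε hM hI)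
    (RealQuad.coverEntropy_X_le hD hsq hε hM t) hW
    fun m hm => RealQuad.encard_image_le_mul_coverMincard hC
      (g := fun s => RealQuad.proj D (RealQuad.code s)) (fun _ hs => hs.2) _
      (hcard _ (fun _ hs => hs.1) m hm)

theorem corollary1 (D : ℕ) (hD : 1 < D) (hsq : Squarefree D)
    (ε : (RealQuad.OK D)ˣ) (hε : RealQuad.IsFundamentalUnit D ε) :
    (RealQuad.IK D ε).Finite ∧
    ∀ t : ℝ, 0 < t → ∀ I : Set (RealQuad.OK D), I.Finite → RealQuad.IK D ε ⊆ I →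
      Filter.Tendsto
        (fun n : ℕ => RealQuad.shiftEntropy
          (RealQuad.SigAvoid D ε n (RealQuad.T D ε n t I)))
        Filter.atTop
        (nhds (Dynamics.coverEntropy (RealQuad.phi D ε) (RealQuad.X D t))) :=
  have h := corollary1_general D hD hsq ε hε.1 fun _ => hε
  ⟨h.1, fun t _ I _ hI => h.2 t I hI⟩
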